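/- A Max 2CSP-$R$ instance on variables $X_1,\dots,X_n$, each ranging over a set $\Sigma$ of size $R\ge 2$, is a finite collection (repetitions allowed) of constraints $f(X_i,X_j)=1$ with $i\neq j$ and $f:\Sigma^2\to\{0,1\}$; its optimum is the maximum number of constraints satisfied by an assignment. Replacing each constraint $f(X_i,X_j)=1$ by the constraints $(X_i=a)\wedge(X_j=b)$, one for each pair with $f(a,b)=1$, reduces an instance $I$ to an instance $I'$ with all constraints of the form $(X_i=a)\wedge(X_j=b)$. The SDP relaxation of an instance with constraints of this form, over vectors $x_{i,a}\in\mathbb{R}^d$ ($d\ge 1$), is to maximize $\sum_{(X_i=a)\wedge(X_j=b)}\langle x_{i,a},x_{j,b}\rangle$ subject to $\sum_a\|x_{i,a}\|^2=1$ for all $i$; $\langle x_{i,a},x_{i,b}\rangle=0$ for all $i$ and $a\ne b$; and $\langle x_{i,a},x_{j,b}\rangle\ge 0$ for all $i,j,a,b$. Rounding a feasible solution $x$: let $p_{i,a}=\frac12\left(\frac{\|x_{i,a}\|}{\sqrt R}+\frac1R\right)$ and let $t_{i,a}$ be the number with $\Pr[N\ge t_{i,a}]=p_{i,a}$ for a standard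 normal $N$. Draw one standard Gaussian vector $g$ in $\mathbb{R}^d$, let $L_i=\{a : x_{i,a}\ne 0,\ \langle x_{i,a},g\rangle\ge\|x_{i,a}\|\,t_{i,a}\}$, and, given $g$, choose $Z_i$ uniformly from $L_i$, independently for the different $i$ (if $L_i=\emptyset$ no value is chosen, and the constraints involving $X_i$ count as not satisfied). **Theorem.** There is an absolute constant $c>0$ such that for all $n$, all $R\ge2$ and all $d\ge1$: 1. For every instance with constraints of the form $(X_i=a)\wedge(X_j=b)$, $i\ne j$, and every feasible solution $x$ of its SDP relaxation, the expected number of constraints satisfied by the rounded assignment $Z$ is at least $c\,\frac{\log R}{R}$ times the SDP objective value of $x$. 2. For every Max 2CSP-$R$ instance $I$, the SDP relaxation of $I'$ has an optimal solution; and for every optimal solution $x$ of it, the SDP value is at least the optimum of $I$, and the expected number of constraints of $I$ satisfied by the rounded assignment $Z$ is at least $c\,\frac{\log R}{R}$ times the optimum of $I$. So the algorithm is an $\Omega(\log R/R)$-approximation for Max 2CSP-$R$. -/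

import Mathlib

open MeasureTheory ProbabilityTheory

namespace TwoCSP

noncomputable section

/-! ### Instances of Max 2CSP-R -/

/-- A constraint `pred (X_i, X_j) = 1` on two distinct variables among `X_0, …, X_{n-1}`,
which range over an alphabet of size `R`. -/
structure Constraint (n R : ℕ) where
  i : Fin n
  j : Fin n
  ne : i ≠ j
  pred : Fin R → Fin R → Bool

/-- A constraint of the form `(X_i = a) ∧ (X_j = b)`, `i ≠ j`. -/
structure AndConstraint (n R : ℕ) where
  i : Fin n
  j : Fin n
  ne : i ≠ j
  a : Fin R
  b : Fin R

/-- A Max 2CSP-R instance: a finite collection of constraints, repetitions allowed. -/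
abbrev Instance (n R : ℕ) := Multiset (Constraint n R)

/-- A Max 2CSP-R instance all of whose constraints have the form `(X_i = a) ∧ (X_j = b)`. -/
abbrev AndInstance (n R : ℕ) := Multiset (AndConstraint n R)

/-- A partial assignment; `none` means that no value is chosen. -/
abbrev PartialAssignment (n R : ℕ) := Fin n → Option (Fin R)

/-- `z` satisfies `C`: both variables are assigned and the predicate holds. -/
def Constraint.Sat {n R : ℕ} (C : Constraint n R) (z : PartialAssignment n R) : Prop :=
  ∃ a b, z C.i = some a ∧ z C.j = some b ∧ C.pred a b = true

def AndConstraint.Sat {n R : ℕ} (C : AndConstraint n R) (z : PartialAssignment n R) : Prop :=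
  z C.i = some C.a ∧ z C.j = some C.b

open Classical in
/-- The number of constraints of `I` satisfied by `z`. -/
def satCount {n R : ℕ} (I : Instance n R) (z : PartialAssignment n R) : ℕ :=
  I.countP (fun C => C.Sat z)

open Classical in
/-- The number of constraints of `I` satisfied by `z`. -/
def andSatCount {n R : ℕ} (I : AndInstance n R) (z : PartialAssignment n R) : ℕ :=
  I.countP (fun C => C.Sat z)

/-- The optimum of a Max 2CSP-R instance: the largest number of constraints satisfied by a
(total) assignment. -/
def opt {n R : ℕ} (I : Instance n R) : ℕ :=
  Finset.univ.sup (fun σ : Fin n → Fin R => satCount I (fun i => some (σ i)))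

/-- Replace a constraint by one constraint `(X_i = a) ∧ (X_j = b)` for each of its satisfying
pairs `(a, b)`. -/
def Constraint.split {n R : ℕ} (C : Constraint n R) : AndInstance n R :=
  (Finset.univ.filter (fun q : Fin R × Fin R => C.pred q.1 q.2 = true)).val.map
    (fun q => ⟨C.i, C.j, C.ne, q.1, q.2⟩)

/-- The reduction of a general instance to one with constraints `(X_i = a) ∧ (X_j = b)`. -/
def reduce {n R : ℕ} (I : Instance n R) : AndInstance n R :=
  I.bind Constraint.split

/-! ### The semidefinite relaxation -/

/-- A candidate SDP solution: a vector `x i a ∈ ℝᵈ` for each variable `i` and value `a`. -/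
abbrev VectorFamily (n R d : ℕ) := Fin n → Fin R → EuclideanSpace ℝ (Fin d)

structure IsFeasible {n R d : ℕ} (x : VectorFamily n R d) : Prop where
  sum_norm_sq : ∀ i, ∑ a, ‖x i a‖ ^ 2 = 1
  inner_eq_zero : ∀ i a b, a ≠ b → inner ℝ (x i a) (x i b) = 0
  inner_nonneg : ∀ i j a b, 0 ≤ inner ℝ (x i a) (x j b)

/-- The SDP objective `∑_{C = (X_i = a) ∧ (X_j = b)} ⟨x_{i,a}, x_{j,b}⟩`. -/
def sdpObjective {n R d : ℕ} (I : AndInstance n R) (x : VectorFamily n R d) : ℝ :=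
  (I.map (fun C => inner ℝ (x C.i C.a) (x C.j C.b))).sum

/-- `x` is an optimal solution of the SDP relaxation of `I`, over vectors in `ℝᵈ`. -/
def IsOptimal {n R d : ℕ} (I : AndInstance n R) (x : VectorFamily n R d) : Prop :=
  IsFeasible x ∧ ∀ y : VectorFamily n R d, IsFeasible y → sdpObjective I y ≤ sdpObjective I x

/-! ### The rounding algorithm -/

/-- `Pr[N ≥ t]` for a standard normal `N`. -/
def gaussianTail (t : ℝ) : ℝ := (gaussianReal 0 1).real (Set.Ici t)

/-- The number `t` with `Pr[N ≥ t] = p` (for `0 < p < 1`, see `gaussianTail_threshold`). -/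
def threshold (p : ℝ) : ℝ := sSup {t : ℝ | p ≤ gaussianTail t}

theorem gaussianTail_eq (t : ℝ) : gaussianTail t = 1 - cdf (gaussianReal 0 1) t := by
  have hna := nullSingletonClass_gaussianReal (μ := 0) (v := 1) one_ne_zero
  have h : Set.Ici t = (Set.Iio t)ᶜ := by simp
  rw [gaussianTail, h, measureReal_compl measurableSet_Iio, cdf_eq_real,
    measureReal_congr (Iio_ae_eq_Iic (μ := gaussianReal 0 1) (a := t))]
  simp

theorem continuous_gaussianTail : Continuous gaussianTail := by
  have : gaussianTail = fun t => 1 - cdf (gaussianReal 0 1) t := funext gaussianTail_eq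
  rw [this]
  refine continuous_const.sub (continuous_iff_continuousAt.2 fun t => ?_)
  rw [(monotone_cdf _).continuousAt_iff_leftLim_eq_rightLim, StieltjesFunction.rightLim_eq]
  have hna := nullSingletonClass_gaussianReal (μ := 0) (v := 1) one_ne_zero
  have h := (cdf (gaussianReal 0 1)).measure_singleton t
  rw [measure_cdf, measure_singleton, eq_comm, ENNReal.ofReal_eq_zero] at h
  exact le_antisymm ((monotone_cdf _).leftLim_le le_rfl) (by linarith)

theorem gaussianTail_threshold {p : ℝ} (h0 : 0 < p) (h1 : p < 1) :
    gaussianTail (threshold p) = p := by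
  have hanti : Antitone gaussianTail := fun s t hst =>
    measureReal_mono (Set.Ici_subset_Ici.2 hst)
  have hbot : Filter.Tendsto gaussianTail Filter.atBot (nhds 1) := by
    have := (tendsto_cdf_atBot (gaussianReal 0 1)).const_sub 1
    simpa [← gaussianTail_eq] using this
  have htop : Filter.Tendsto gaussianTail Filter.atTop (nhds 0) := by
    have := (tendsto_cdf_atTop (gaussianReal 0 1)).const_sub 1
    simpa [← gaussianTail_eq] using this
  obtain ⟨u, hu⟩ := (htop.eventually (gt_mem_nhds h0)).exists
  obtain ⟨l, hl⟩ := (hbot.eventually (lt_mem_nhds h1)).exists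
  obtain ⟨t, ht⟩ : ∃ t, gaussianTail t = p :=
    mem_range_of_exists_le_of_exists_ge continuous_gaussianTail ⟨u, hu.le⟩ ⟨l, hl.le⟩
  have hbdd : BddAbove {t : ℝ | p ≤ gaussianTail t} := by
    refine ⟨u, fun s hs => ?_⟩
    by_contra hlt
    have := hanti (not_le.1 hlt).le
    change p ≤ gaussianTail s at hs
    linarith
  have hmem : threshold p ∈ {t : ℝ | p ≤ gaussianTail t} :=
    (isClosed_le continuous_const continuous_gaussianTail).csSup_mem ⟨t, ht.ge⟩ hbdd
  have hle : t ≤ threshold p := le_csSup hbdd ht.ge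
  exact le_antisymm ((hanti hle).trans ht.le) hmem

/-- The target probability `p_{i,a} = (‖x_{i,a}‖ / √R + 1 / R) / 2`. -/
def targetProb {n R d : ℕ} (x : VectorFamily n R d) (i : Fin n) (a : Fin R) : ℝ :=
  (1 / 2) * (‖x i a‖ / Real.sqrt R + 1 / R)

open Classical in
/-- The short list `L_i = {a : ⟨x_{i,a}, g⟩ ≥ ‖x_{i,a}‖ t_{i,a}}`, where only values with
`x_{i,a} ≠ 0` may be listed (for `x_{i,a} = 0` the inequality would hold for every `g`). -/
def shortList {n R d : ℕ} (x : VectorFamily n R d) (g : EuclideanSpace ℝ (Fin d))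
    (i : Fin n) : Finset (Fin R) :=
  Finset.univ.filter (fun a =>
    x i a ≠ 0 ∧ ‖x i a‖ * threshold (targetProb x i a) ≤ inner ℝ (x i a) g)

/-- A uniformly random element of `L`; no value if `L` is empty. -/
def pick {R : ℕ} (L : Finset (Fin R)) : PMF (Option (Fin R)) :=
  if h : L.Nonempty then (PMF.uniformOfFinset L h).map some else PMF.pure none

instance instMeasurableSpaceOptionFin (R : ℕ) : MeasurableSpace (Option (Fin R)) := ⊤

instance instDiscreteOptionFin (R : ℕ) : DiscreteMeasurableSpace (Option (Fin R)) :=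
  ⟨fun _ => trivial⟩

/-- Given the short lists, the values are picked independently for the different variables. -/
def pickLaw {n R : ℕ} (L : Fin n → Finset (Fin R)) : Measure (PartialAssignment n R) :=
  Measure.pi (fun i => (pick (L i)).toMeasure)

theorem measurable_pickLaw_shortList {n R d : ℕ} (x : VectorFamily n R d) :
    Measurable (fun g => pickLaw (shortList x g)) := by
  let _ : MeasurableSpace (Fin n → Finset (Fin R)) := ⊤
  have hL : Measurable (fun g => shortList x g) := by
    refine measurable_to_countable' fun L => ?_
    have hset : (fun g => shortList x g) ⁻¹' {L} = ⋂ (i : Fin n) (a : Fin R),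
        {g | (x i a ≠ 0 ∧ ‖x i a‖ * threshold (targetProb x i a) ≤ inner ℝ (x i a) g) ↔
          a ∈ L i} := by
      ext g
      simp [funext_iff, Finset.ext_iff, shortList]
    rw [hset]
    refine MeasurableSet.iInter fun i => MeasurableSet.iInter fun a => ?_
    have h1 : MeasurableSet {g : EuclideanSpace ℝ (Fin d) |
        ‖x i a‖ * threshold (targetProb x i a) ≤ inner ℝ (x i a) g} :=
      measurableSet_le measurable_const (by fun_prop)
    exact ((MeasurableSet.const _).inter h1).iff (MeasurableSet.const _)
  have hP : Measurable (fun L : Fin n → Finset (Fin R) => pickLaw L) := measurable_from_top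
  exact hP.comp hL

/-- The law of the rounded assignment `Z` given the Gaussian vector `g`. -/
def roundingKernel {n R d : ℕ} (x : VectorFamily n R d) :
    Kernel (EuclideanSpace ℝ (Fin d)) (PartialAssignment n R) :=
  ⟨fun g => pickLaw (shortList x g), measurable_pickLaw_shortList x⟩

/-- The law of the assignment `Z` produced by the rounding algorithm: draw one standard
Gaussian vector `g` in `ℝᵈ`, form the short lists, and pick from them. -/
def roundingLaw {n R d : ℕ} (x : VectorFamily n R d) : Measure (PartialAssignment n R) :=
  (stdGaussian (EuclideanSpace ℝ (Fin d))).bind (roundingKernel x)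

end

end TwoCSP

open TwoCSP

namespace TwoCSP

/-! ### Tails of the standard normal distribution -/

/-! By linearity it suffices to show, for one pair of values with directions `u`, `w` and `ρ = ⟨u,
w⟩`, that both are picked with probability at least a constant times `(log R / R) ⟨x_{i,a},
x_{j,b}⟩` (`exists_const_le_roundingLaw_real`). Given `g`, this probability is `1 / (|L_i| |L_j|)`
when both values are listed. So one looks for an event `A` on which both are listed, which is likely
enough, and on which the mean list lengths are `O(1)`; convexity of `1 / (k l)` then gives `Pr[A] /
m²` (`le_roundingLaw_real`).

Let `p`, `q` be the two target probabilities, with thresholds `s ≥ t`, and put `l = √(log R)`. For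
large `R` all thresholds are of order `l`. Write `w = ρ u + r v` with `v ⟂ u`. The event asks that
`⟨u, g⟩ ≥ s` and `⟨v, g⟩ ≥ t (1 - ρ / 2)`, both capped at `3 l`; it forces `⟨w, g⟩ ≥ t`. Lowering
the second threshold by `ρ t / 2` makes that tail at least of order `ρ t² q`, since the Gaussian
density at `t` is at least `t` times the tail. As `t²` is of order `log R`, `Pr[A]` is at least of
order `p q ρ log R` (`exists_event_of_threshold_le`), and `p q ≥ ‖x_{i,a}‖ ‖x_{j,b}‖ / (4 R)`.

Conditioning on `A` shifts any other direction of the same variable by at most `3 l τ`, where `τ` is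
its correlation with `v` (for variable `i`) or `u` (for variable `j`). Such a shift multiplies a
tail by a constant, up to an additive `O(τ²)` (`gaussianTail_shift_le`). The directions of one
variable are orthogonal, so Bessel bounds the sum of `τ²` by `1`; the target probabilities also sum
to at most `1`. Hence the lists have bounded mean length on `A` (`sum_real_mem_shortList_le`).

For bounded `R` the crude bounds `|L_i| ≤ R` and thresholds `≤ 8` suffice. The second claim adds
that the reduction preserves the count of satisfied constraints and that assignments embed as
feasible solutions. -/

theorem gaussianTail_antitone : Antitone gaussianTail := fun _ _ h =>
  measureReal_mono (Set.Ici_subset_Ici.2 h)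

theorem gaussianTail_nonneg (t : ℝ) : 0 ≤ gaussianTail t := measureReal_nonneg

theorem gaussianTail_eq_integral (t : ℝ) :
    gaussianTail t = ∫ y in Set.Ici t, gaussianPDFReal 0 1 y := by
  rw [gaussianTail, measureReal_def, gaussianReal_apply_eq_integral _ one_ne_zero,
    ENNReal.toReal_ofReal (integral_nonneg fun y => gaussianPDFReal_nonneg 0 1 y)]

theorem gaussianTail_sub_eq_integral {a b : ℝ} (hab : a ≤ b) :
    gaussianTail a - gaussianTail b = ∫ y in Set.Ico a b, gaussianPDFReal 0 1 y := by
  have hU : Set.Ici a = Set.Ico a b ∪ Set.Ici b := (Set.Ico_union_Ici_eq_Ici hab).symm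
  have hd : Disjoint (Set.Ico a b) (Set.Ici b) :=
    Set.disjoint_left.2 fun y hy hy' => absurd hy.2 (not_lt.2 hy')
  rw [gaussianTail_eq_integral, gaussianTail_eq_integral, hU,
    setIntegral_union hd measurableSet_Ici (integrable_gaussianPDFReal 0 1).integrableOn
      (integrable_gaussianPDFReal 0 1).integrableOn]
  ring

theorem gaussianPDFReal_std (y : ℝ) :
    gaussianPDFReal 0 1 y = (Real.sqrt (2 * Real.pi))⁻¹ * Real.exp (-y ^ 2 / 2) := by
  simp [gaussianPDFReal]

theorem gaussianPDFReal_std_anti {a b : ℝ} (ha : 0 ≤ a) (hab : a ≤ b) :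
    gaussianPDFReal 0 1 b ≤ gaussianPDFReal 0 1 a := by
  rw [gaussianPDFReal_std, gaussianPDFReal_std]
  gcongr

theorem le_gaussianTail_sub {a b : ℝ} (ha : 0 ≤ a) (hab : a ≤ b) :
    (b - a) * gaussianPDFReal 0 1 b ≤ gaussianTail a - gaussianTail b := by
  rw [gaussianTail_sub_eq_integral hab]
  have h : ∫ _ in Set.Ico a b, gaussianPDFReal 0 1 b ≤
      ∫ y in Set.Ico a b, gaussianPDFReal 0 1 y :=
    setIntegral_mono_on (by simp) (integrable_gaussianPDFReal 0 1).integrableOn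
      measurableSet_Ico fun y hy => gaussianPDFReal_std_anti (ha.trans hy.1) hy.2.le
  simpa [hab] using h

theorem gaussianTail_sub_le {a b : ℝ} (ha : 0 ≤ a) (hab : a ≤ b) :
    gaussianTail a - gaussianTail b ≤ (b - a) * gaussianPDFReal 0 1 a := by
  rw [gaussianTail_sub_eq_integral hab]
  have h : ∫ y in Set.Ico a b, gaussianPDFReal 0 1 y ≤
      ∫ _ in Set.Ico a b, gaussianPDFReal 0 1 a :=
    setIntegral_mono_on (integrable_gaussianPDFReal 0 1).integrableOn (by simp)
      measurableSet_Ico fun y hy => gaussianPDFReal_std_anti ha hy.1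
  simpa [hab] using h

theorem hasDerivAt_neg_gaussianPDFReal_std (y : ℝ) :
    HasDerivAt (fun y => -gaussianPDFReal 0 1 y) (y * gaussianPDFReal 0 1 y) y := by
  simp only [gaussianPDFReal_std]
  have h : HasDerivAt (fun y : ℝ => -y ^ 2 / 2) (-(2 * y) / 2) y := by
    simpa using ((hasDerivAt_pow 2 y).fun_neg).div_const 2
  exact (h.exp.const_mul (Real.sqrt (2 * Real.pi))⁻¹).fun_neg.congr_deriv (by ring)

/-- Mills' inequality: on `[t, ∞)` replace the factor `t` by `y`, and `y φ(y)` has antiderivative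
`-φ(y)`. -/
theorem mul_gaussianTail_le {t : ℝ} (ht : 0 ≤ t) :
    t * gaussianTail t ≤ gaussianPDFReal 0 1 t := by
  have hlim : Filter.Tendsto (fun y => -gaussianPDFReal 0 1 y) Filter.atTop (nhds 0) := by
    simp only [gaussianPDFReal_std]
    have h1 : Filter.Tendsto (fun y : ℝ => -y ^ 2 / 2) Filter.atTop Filter.atBot := by
      have : Filter.Tendsto (fun y : ℝ => y ^ 2 / 2) Filter.atTop Filter.atTop :=
        (Filter.tendsto_pow_atTop two_ne_zero).atTop_div_const two_pos
      exact (Filter.tendsto_neg_atTop_atBot.comp this).congr fun y => (neg_div _ _).symm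
    simpa using ((Real.tendsto_exp_atBot.comp h1).const_mul (Real.sqrt (2 * Real.pi))⁻¹).neg
  have hnn : ∀ y ∈ Set.Ioi t, 0 ≤ y * gaussianPDFReal 0 1 y := fun y hy =>
    mul_nonneg (ht.trans hy.le) (gaussianPDFReal_nonneg 0 1 y)
  have hint := integrableOn_Ioi_deriv_of_nonneg'
    (fun y _ => hasDerivAt_neg_gaussianPDFReal_std y) hnn hlim
  have hval := integral_Ioi_of_hasDerivAt_of_tendsto'
    (fun y _ => hasDerivAt_neg_gaussianPDFReal_std y) hint hlim
  have hle : ∫ y in Set.Ioi t, t * gaussianPDFReal 0 1 y ≤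
      ∫ y in Set.Ioi t, y * gaussianPDFReal 0 1 y :=
    setIntegral_mono_on ((integrable_gaussianPDFReal 0 1).integrableOn.const_mul t) hint
      measurableSet_Ioi fun y hy =>
        mul_le_mul_of_nonneg_right hy.le (gaussianPDFReal_nonneg 0 1 y)
  rw [integral_const_mul, hval, ← integral_Ici_eq_integral_Ioi,
    ← gaussianTail_eq_integral] at hle
  linarith

theorem one_le_sqrt_two_pi : 1 ≤ Real.sqrt (2 * Real.pi) := by
  rw [Real.one_le_sqrt]
  linarith [Real.pi_gt_three]

theorem sqrt_two_pi_le : Real.sqrt (2 * Real.pi) ≤ 3 := by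
  rw [Real.sqrt_le_left (by norm_num)]
  linarith [Real.pi_lt_four]

theorem gaussianTail_le_exp {t : ℝ} (ht : 1 ≤ t) : gaussianTail t ≤ Real.exp (-t ^ 2 / 2) := by
  have h1 := mul_gaussianTail_le (zero_le_one.trans ht)
  have h2 : gaussianTail t ≤ t * gaussianTail t :=
    le_mul_of_one_le_left (gaussianTail_nonneg t) ht
  have h3 : gaussianPDFReal 0 1 t ≤ Real.exp (-t ^ 2 / 2) := by
    rw [gaussianPDFReal_std]
    exact mul_le_of_le_one_left (Real.exp_pos _).le (inv_le_one_of_one_le₀ one_le_sqrt_two_pi)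
  linarith

theorem gaussianTail_pos (t : ℝ) : 0 < gaussianTail t := by
  have h := le_gaussianTail_sub (abs_nonneg t) (show |t| ≤ |t| + 1 by linarith)
  have h1 := gaussianPDFReal_pos 0 1 (|t| + 1) one_ne_zero
  have h2 := gaussianTail_nonneg (|t| + 1)
  have h3 := gaussianTail_antitone (le_abs_self t)
  linarith

/-- Converse of Mills' inequality up to a constant: on `[t, t + 1/t]` the density drops by a factor
of at most `e^{3/2}`, because the exponent changes by `1 + 1/(2 t²)`. -/
theorem gaussianPDFReal_std_le_mul_gaussianTail {t : ℝ} (ht : 1 ≤ t) :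
    gaussianPDFReal 0 1 t ≤ Real.exp (3 / 2) * (t * gaussianTail t) := by
  have ht0 : 0 < t := by linarith
  have h := le_gaussianTail_sub ht0.le (show t ≤ t + t⁻¹ by linarith [inv_pos.2 ht0])
  have h2 := gaussianTail_nonneg (t + t⁻¹)
  have h3 : gaussianPDFReal 0 1 t ≤ Real.exp (3 / 2) * gaussianPDFReal 0 1 (t + t⁻¹) := by
    rw [gaussianPDFReal_std, gaussianPDFReal_std, mul_left_comm, ← Real.exp_add]
    gcongr
    have h4 : t⁻¹ ≤ 1 := inv_le_one_of_one_le₀ ht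
    have h5 : t⁻¹ * t = 1 := inv_mul_cancel₀ ht0.ne'
    have h6 : 0 ≤ t⁻¹ := (inv_pos.2 ht0).le
    nlinarith
  have h7 : gaussianPDFReal 0 1 (t + t⁻¹) ≤ t * gaussianTail t := by
    have h8 : t⁻¹ * gaussianPDFReal 0 1 (t + t⁻¹) ≤ gaussianTail t := by
      rw [add_sub_cancel_left] at h
      linarith
    rwa [inv_mul_le_iff₀ ht0] at h8
  exact h3.trans (mul_le_mul_of_nonneg_left h7 (Real.exp_pos _).le)

/-- Shifting a threshold of order `ℓ` down by `3 ℓ τ` raises the tail by a constant factor, up to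
an additive term of order `τ²`. -/
theorem gaussianTail_shift_le {l t τ : ℝ} (hl : 4 ≤ l) (ht1 : l / 2 ≤ t) (ht2 : t ≤ 2 * l)
    (h0 : 0 ≤ τ) (h1 : τ ≤ 1 / 12) :
    gaussianTail (t - 3 * l * τ) ≤ 6 * Real.exp 8 * gaussianTail t + 2048 * τ ^ 2 := by
  have hlτ : 3 * l * τ ≤ l / 4 := by nlinarith
  -- If `τ l² ≤ 1`, the shift times `t` is at most `6`, so the density grows by at most `e⁶` along
  -- the shift. Otherwise the tail at `l / 4` is already `O(l⁻⁴)`, hence `O(τ²)`.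
  by_cases hτ : τ * l ^ 2 ≤ 1
  · have hd : 0 ≤ 3 * l * τ := by positivity
    have hs := gaussianTail_sub_le (show 0 ≤ t - 3 * l * τ by linarith)
      (show t - 3 * l * τ ≤ t by linarith)
    have hphi : gaussianPDFReal 0 1 (t - 3 * l * τ) ≤ Real.exp 6 * gaussianPDFReal 0 1 t := by
      rw [gaussianPDFReal_std, gaussianPDFReal_std, mul_left_comm, ← Real.exp_add]
      gcongr
      nlinarith [mul_nonneg h0 (show 0 ≤ l by linarith)]
    have hM := gaussianPDFReal_std_le_mul_gaussianTail (show 1 ≤ t by linarith)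
    have hT := gaussianTail_pos t
    have he : Real.exp 6 * Real.exp (3 / 2) ≤ Real.exp 8 - 1 := by
      have h8 : Real.exp 8 = Real.exp 6 * Real.exp (3 / 2) * Real.exp (1 / 2) := by
        rw [← Real.exp_add, ← Real.exp_add]; norm_num
      have hh : 1 + 1 / 2 ≤ Real.exp (1 / 2) := by
        have := Real.add_one_le_exp (1 / 2 : ℝ); linarith
      have h2 : 2 ≤ Real.exp 6 * Real.exp (3 / 2) := by
        rw [← Real.exp_add]
        have := Real.add_one_le_exp (6 + 3 / 2 : ℝ)
        linarith
      nlinarith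
    have h2 : (t - (t - 3 * l * τ)) * gaussianPDFReal 0 1 (t - 3 * l * τ)
        ≤ 3 * l * τ * (Real.exp 6 * (Real.exp (3 / 2) * (t * gaussianTail t))) := by
      rw [sub_sub_cancel]
      exact mul_le_mul_of_nonneg_left
        (hphi.trans (mul_le_mul_of_nonneg_left hM (Real.exp_pos _).le)) hd
    have h3 : 3 * l * τ * t ≤ 6 := by nlinarith [mul_nonneg h0 (show 0 ≤ l by linarith)]
    have h4 : 3 * l * τ * (Real.exp 6 * (Real.exp (3 / 2) * (t * gaussianTail t)))
        ≤ 6 * ((Real.exp 8 - 1) * gaussianTail t) := by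
      have : 3 * l * τ * (Real.exp 6 * (Real.exp (3 / 2) * (t * gaussianTail t)))
        = (3 * l * τ * t) * ((Real.exp 6 * Real.exp (3 / 2)) * gaussianTail t) := by ring
      rw [this]
      gcongr
    nlinarith [sq_nonneg τ]
  · have h2 : gaussianTail (t - 3 * l * τ) ≤ gaussianTail (l / 4) :=
      gaussianTail_antitone (by linarith)
    have h3 := gaussianTail_le_exp (show 1 ≤ l / 4 by linarith)
    -- With `y = l² / 32`, the quadratic term `y² / 2` of `exp y` equals `l⁴ / 2048`.
    have h4 : Real.exp (-(l / 4) ^ 2 / 2) * l ^ 4 ≤ 2048 := by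
      have h5 := Real.quadratic_le_exp_of_nonneg (show 0 ≤ (l / 4) ^ 2 / 2 by positivity)
      rw [neg_div, Real.exp_neg, inv_mul_le_iff₀ (Real.exp_pos _)]
      nlinarith [sq_nonneg l]
    have h6 : 1 ≤ (τ * l ^ 2) ^ 2 := one_le_pow₀ (not_le.1 hτ).le
    have h7 : Real.exp (-(l / 4) ^ 2 / 2) ≤ 2048 * τ ^ 2 := by
      calc Real.exp (-(l / 4) ^ 2 / 2) ≤ Real.exp (-(l / 4) ^ 2 / 2) * (τ * l ^ 2) ^ 2 :=
            le_mul_of_one_le_right (Real.exp_pos _).le h6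
        _ = Real.exp (-(l / 4) ^ 2 / 2) * l ^ 4 * τ ^ 2 := by ring
        _ ≤ 2048 * τ ^ 2 := by gcongr
    have h8 : 0 ≤ 6 * Real.exp 8 * gaussianTail t :=
      mul_nonneg (by positivity) (gaussianTail_nonneg t)
    linarith

/-- A unit interval starting at `l / 2` stays below `3 l / 4`, and the density at `3 l / 4` already
exceeds `exp(-l² / 2)`. With `l² = log R` the bound on the tail reads `1 / √R`, the largest possible
target probability. -/
theorem half_le_of_gaussianTail_le {l t : ℝ} (hl : 4 ≤ l)
    (ht : gaussianTail t ≤ Real.exp (-l ^ 2 / 2)) : l / 2 ≤ t := by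
  by_contra! h
  have h1 := gaussianTail_antitone h.le
  have h2 := le_gaussianTail_sub (show 0 ≤ l / 2 by linarith) (show l / 2 ≤ l / 2 + 1 by linarith)
  have h3 := gaussianTail_nonneg (l / 2 + 1)
  have h4 := gaussianPDFReal_std_anti (show 0 ≤ l / 2 + 1 by linarith)
    (show l / 2 + 1 ≤ 3 * l / 4 by linarith)
  have h5 : Real.exp (-l ^ 2 / 2) < gaussianPDFReal 0 1 (3 * l / 4) := by
    rw [gaussianPDFReal_std, lt_inv_mul_iff₀ (by linarith [one_le_sqrt_two_pi])]
    have h6 : Real.exp (-(3 * l / 4) ^ 2 / 2)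
        = Real.exp (7 * l ^ 2 / 32) * Real.exp (-l ^ 2 / 2) := by
      rw [← Real.exp_add]; congr 1; ring
    rw [h6]
    gcongr
    have := Real.add_one_le_exp (7 * l ^ 2 / 32)
    nlinarith [sqrt_two_pi_le]
  linarith

theorem le_of_le_gaussianTail {l t : ℝ} (hl : 4 ≤ l)
    (ht : (1 / 2) * Real.exp (-l ^ 2) ≤ gaussianTail t) : t ≤ 2 * l := by
  by_contra! h
  have h1 := gaussianTail_antitone h.le
  have h2 := gaussianTail_le_exp (show 1 ≤ 2 * l by linarith)
  have h3 : Real.exp (-l ^ 2) = Real.exp (l ^ 2) * Real.exp (-(2 * l) ^ 2 / 2) := by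
    rw [← Real.exp_add]; congr 1; ring
  have h4 := Real.add_one_le_exp (l ^ 2)
  have h5 := Real.exp_pos (-(2 * l) ^ 2 / 2)
  have h6 : 2 * Real.exp (-(2 * l) ^ 2 / 2) < Real.exp (l ^ 2) * Real.exp (-(2 * l) ^ 2 / 2) :=
    mul_lt_mul_of_pos_right (by nlinarith) h5
  linarith

/-- Capping projections at `3 l` costs at most `1 / (4 R)` when `l² = log R`, which is half of the
least possible target probability. -/
theorem gaussianTail_three_mul_le {l : ℝ} (hl : 4 ≤ l) :
    gaussianTail (3 * l) ≤ (1 / 4) * Real.exp (-l ^ 2) := by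
  have h2 := gaussianTail_le_exp (show 1 ≤ 3 * l by linarith)
  have h3 : Real.exp (-l ^ 2) = Real.exp (7 / 2 * l ^ 2) * Real.exp (-(3 * l) ^ 2 / 2) := by
    rw [← Real.exp_add]; congr 1; ring
  have h4 := Real.add_one_le_exp (7 / 2 * l ^ 2)
  have h5 := Real.exp_pos (-(3 * l) ^ 2 / 2)
  have h6 : 4 * Real.exp (-(3 * l) ^ 2 / 2)
      ≤ Real.exp (7 / 2 * l ^ 2) * Real.exp (-(3 * l) ^ 2 / 2) :=
    mul_le_mul_of_nonneg_right (by nlinarith) h5.le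
  linarith

/-! ### One-dimensional projections of a standard Gaussian vector -/

section Projections

variable {E : Type*} [NormedAddCommGroup E] [InnerProductSpace ℝ E] [FiniteDimensional ℝ E]
  [MeasurableSpace E] [BorelSpace E]

theorem map_inner_stdGaussian {u : E} (hu : ‖u‖ = 1) :
    (stdGaussian E).map (fun g => inner ℝ u g) = gaussianReal 0 1 := by
  have h : HasGaussianLaw (fun g : E => inner ℝ u g) (stdGaussian E) :=
    (IsGaussian.hasGaussianLaw_id (μ := stdGaussian E)).map (innerSL ℝ u)
  have hm : ∫ g, inner ℝ u g ∂(stdGaussian E) = 0 :=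
    integral_strongDual_stdGaussian (innerSL ℝ u)
  have hv : Var[fun g : E => inner ℝ u g; stdGaussian E] = 1 := by
    have := variance_dual_stdGaussian (innerSL ℝ u)
    rw [innerSL_apply_norm, hu, one_pow] at this
    exact this
  rw [h.map_eq_gaussianReal, hm, hv, Real.toNNReal_one]

theorem iIndepFun_inner_stdGaussian {ι : Type*} [Fintype ι] {v : ι → E}
    (hv : ∀ i j, i ≠ j → inner ℝ (v i) (v j) = 0) :
    iIndepFun (fun i (g : E) => inner ℝ (v i) g) (stdGaussian E) := by
  have h : HasGaussianLaw (fun (g : E) i => inner ℝ (v i) g) (stdGaussian E) :=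
    (IsGaussian.hasGaussianLaw_id (μ := stdGaussian E)).map
      (ContinuousLinearMap.pi fun i => innerSL ℝ (v i))
  refine h.iIndepFun_of_covariance_eq_zero fun i j hij => ?_
  rw [← covarianceBilin_apply_eq_cov IsGaussian.memLp_two_id, covarianceBilin_stdGaussian]
  exact hv i j hij

/-- Uncorrelated jointly Gaussian projections are independent. No vector is required to be nonzero,
so degenerate components need no separate treatment. -/
theorem stdGaussian_real_inner_mem_and {u v w : E} (huv : inner ℝ u v = 0)
    (huw : inner ℝ u w = 0) (hvw : inner ℝ v w = 0) {S T U : Set ℝ} (hS : MeasurableSet S)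
    (hT : MeasurableSet T) (hU : MeasurableSet U) :
    (stdGaussian E).real {g | inner ℝ u g ∈ S ∧ inner ℝ v g ∈ T ∧ inner ℝ w g ∈ U} =
      (stdGaussian E).real {g | inner ℝ u g ∈ S} * (stdGaussian E).real {g | inner ℝ v g ∈ T} *
        (stdGaussian E).real {g | inner ℝ w g ∈ U} := by
  have hvu : inner ℝ v u = 0 := (real_inner_comm u v).trans huv
  have hwu : inner ℝ w u = 0 := (real_inner_comm u w).trans huw
  have hwv : inner ℝ w v = 0 := (real_inner_comm v w).trans hvw
  have h := iIndepFun_inner_stdGaussian (v := ![u, v, w]) (by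
    intro i j hij
    fin_cases i <;> fin_cases j <;> first
      | exact absurd rfl hij
      | exact huv
      | exact huw
      | exact hvu
      | exact hvw
      | exact hwu
      | exact hwv)
  have h2 := h.measure_inter_preimage_eq_mul Finset.univ (sets := ![S, T, U]) (by
    intro i _
    fin_cases i <;> assumption)
  have h3 : {g : E | inner ℝ u g ∈ S ∧ inner ℝ v g ∈ T ∧ inner ℝ w g ∈ U} =
      ⋂ i ∈ (Finset.univ : Finset (Fin 3)),
        (fun g : E => inner ℝ (![u, v, w] i) g) ⁻¹' (![S, T, U] i) := by
    ext g
    simp [Fin.forall_fin_succ]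
  rw [measureReal_def, h3, h2]
  simp [Fin.prod_univ_three, measureReal_def, Set.preimage]

theorem stdGaussian_real_inner_mem_and₂ {u v : E} (huv : inner ℝ u v = 0)
    {S T : Set ℝ} (hS : MeasurableSet S) (hT : MeasurableSet T) :
    (stdGaussian E).real {g | inner ℝ u g ∈ S ∧ inner ℝ v g ∈ T} =
      (stdGaussian E).real {g | inner ℝ u g ∈ S} * (stdGaussian E).real {g | inner ℝ v g ∈ T} := by
  simpa using stdGaussian_real_inner_mem_and (w := (0 : E)) huv (by simp) (by simp) hS hT
    MeasurableSet.univ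

theorem stdGaussian_real_inner_mem {u : E} (hu : ‖u‖ = 1) {S : Set ℝ} (hS : MeasurableSet S) :
    (stdGaussian E).real {g | inner ℝ u g ∈ S} = (gaussianReal 0 1).real S := by
  rw [← map_inner_stdGaussian hu, map_measureReal_apply (by fun_prop) hS]
  rfl

theorem stdGaussian_real_le_inner {u : E} (hu : ‖u‖ = 1) (t : ℝ) :
    (stdGaussian E).real {g | t ≤ inner ℝ u g} = gaussianTail t :=
  stdGaussian_real_inner_mem hu measurableSet_Ici

theorem le_stdGaussian_real_inner_mem_Icc {u : E} (hu : ‖u‖ = 1) (a b : ℝ) :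
    gaussianTail a - gaussianTail b ≤ (stdGaussian E).real {g | inner ℝ u g ∈ Set.Icc a b} := by
  rw [stdGaussian_real_inner_mem hu measurableSet_Icc, sub_le_iff_le_add, gaussianTail,
    gaussianTail]
  refine (measureReal_mono fun y hy => ?_).trans (measureReal_union_le _ _)
  rcases le_total y b with h | h
  · exact Or.inl ⟨hy, h⟩
  · exact Or.inr h

/-- The tail of a projection onto a vector of norm at most `1` is at most the standard one. -/
theorem stdGaussian_real_le_inner_le {w : E} (hw : ‖w‖ ≤ 1) {t : ℝ} (ht : 0 < t) :
    (stdGaussian E).real {g | t ≤ inner ℝ w g} ≤ gaussianTail t := by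
  rcases eq_or_ne w 0 with rfl | h0
  · simp [ht.not_ge, gaussianTail_nonneg]
  have hn : 0 < ‖w‖ := norm_pos_iff.2 h0
  have he : ‖‖w‖⁻¹ • w‖ = 1 := by
    rw [norm_smul, norm_inv, norm_norm, inv_mul_cancel₀ hn.ne']
  rw [← stdGaussian_real_le_inner he]
  refine measureReal_mono fun g hg => ?_
  simp only [Set.mem_ofPred_eq, real_inner_smul_left] at hg ⊢
  exact hg.trans (le_mul_of_one_le_left (ht.le.trans hg) ((one_le_inv₀ hn).2 hw))

/-- Restricting two orthogonal projections to a region where they contribute at most `m` to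
`⟨w, g⟩` raises the tail of `⟨w, g⟩` by at most a shift by `m`. -/
theorem stdGaussian_real_and_le_inner_le {u v w : E} (hu : ‖u‖ = 1) (hv : ‖v‖ = 1 ∨ v = 0)
    (huv : inner ℝ u v = 0) (hw : ‖w‖ = 1) {S T : Set ℝ} (hS : MeasurableSet S)
    (hT : MeasurableSet T) {m t : ℝ} (hmt : 0 < t - m)
    (hm : ∀ g : E, inner ℝ u g ∈ S → inner ℝ v g ∈ T →
      inner ℝ w u * inner ℝ u g + inner ℝ w v * inner ℝ v g ≤ m) :
    (stdGaussian E).real {g | (inner ℝ u g ∈ S ∧ inner ℝ v g ∈ T) ∧ t ≤ inner ℝ w g} ≤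
      (stdGaussian E).real {g | inner ℝ u g ∈ S ∧ inner ℝ v g ∈ T} * gaussianTail (t - m) := by
  -- The part of `w` orthogonal to `u` and `v`: its projection is independent of the conditioning
  -- event and must make up the missing `t - m`.
  set r : E := w - (inner ℝ w u : ℝ) • u - (inner ℝ w v : ℝ) • v with hr
  have huu : inner ℝ u u = (1 : ℝ) := by rw [real_inner_self_eq_norm_sq, hu, one_pow]
  have hvu : inner ℝ v u = (0 : ℝ) := by rw [real_inner_comm]; exact huv
  have hur : inner ℝ u r = (0 : ℝ) := by
    rw [hr, inner_sub_right, inner_sub_right, inner_smul_right, inner_smul_right, huu, huv,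
      real_inner_comm]
    ring
  have hvr : inner ℝ v r = (0 : ℝ) := by
    rcases hv with hv | rfl
    · have hvv : inner ℝ v v = (1 : ℝ) := by rw [real_inner_self_eq_norm_sq, hv, one_pow]
      rw [hr, inner_sub_right, inner_sub_right, inner_smul_right, inner_smul_right, hvv, hvu,
        real_inner_comm]
      ring
    · simp
  have hrn : ‖r‖ ≤ 1 := by
    have hwr : inner ℝ w r = ‖r‖ ^ 2 := by
      have : w = r + (inner ℝ w u : ℝ) • u + (inner ℝ w v : ℝ) • v := by rw [hr]; abel
      rw [← real_inner_self_eq_norm_sq]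
      conv_lhs => rw [this]
      rw [inner_add_left, inner_add_left, real_inner_smul_left, real_inner_smul_left, hur, hvr]
      ring
    have := real_inner_le_norm w r
    rw [hwr, hw, one_mul] at this
    nlinarith [norm_nonneg r]
  have hdec : ∀ g : E, inner ℝ w g =
      inner ℝ r g + (inner ℝ w u * inner ℝ u g + inner ℝ w v * inner ℝ v g) := by
    intro g
    rw [hr, inner_sub_left, inner_sub_left, real_inner_smul_left, real_inner_smul_left]
    ring
  calc (stdGaussian E).real {g | (inner ℝ u g ∈ S ∧ inner ℝ v g ∈ T) ∧ t ≤ inner ℝ w g}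
      ≤ (stdGaussian E).real
          {g | inner ℝ u g ∈ S ∧ inner ℝ v g ∈ T ∧ inner ℝ r g ∈ Set.Ici (t - m)} := by
        refine measureReal_mono fun g hg => ⟨hg.1.1, hg.1.2, ?_⟩
        have h1 := hm g hg.1.1 hg.1.2
        have h2 : t ≤ inner ℝ w g := hg.2
        rw [hdec] at h2
        change t - m ≤ inner ℝ r g
        linarith
    _ = (stdGaussian E).real {g | inner ℝ u g ∈ S ∧ inner ℝ v g ∈ T} *
          (stdGaussian E).real {g | inner ℝ r g ∈ Set.Ici (t - m)} := by
        rw [stdGaussian_real_inner_mem_and huv hur hvr hS hT measurableSet_Ici,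
          stdGaussian_real_inner_mem_and₂ huv hS hT]
    _ ≤ _ := mul_le_mul_of_nonneg_left (stdGaussian_real_le_inner_le hrn hmt) measureReal_nonneg

end Projections

/-! ### Feasible solutions and short lists -/

section Feasible

variable {n R d : ℕ} {x : VectorFamily n R d}

/-- The direction of `x i a` (zero if `x i a = 0`). -/
noncomputable def dir (x : VectorFamily n R d) (i : Fin n) (a : Fin R) :
    EuclideanSpace ℝ (Fin d) := ‖x i a‖⁻¹ • x i a

theorem norm_dir {i : Fin n} {a : Fin R} (h : x i a ≠ 0) : ‖dir x i a‖ = 1 := by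
  rw [dir, norm_smul, norm_inv, norm_norm, inv_mul_cancel₀ (norm_ne_zero_iff.2 h)]

theorem inner_eq_norm_mul_inner_dir (i j : Fin n) (a b : Fin R) :
    inner ℝ (x i a) (x j b) = ‖x i a‖ * ‖x j b‖ * inner ℝ (dir x i a) (dir x j b) := by
  rcases eq_or_ne (x i a) 0 with h | h
  · simp [h]
  rcases eq_or_ne (x j b) 0 with h' | h'
  · simp [h']
  have h1 := norm_ne_zero_iff.2 h
  have h2 := norm_ne_zero_iff.2 h'
  rw [dir, dir, real_inner_smul_left, real_inner_smul_right]
  field_simp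

theorem IsFeasible.inner_dir_nonneg (hx : IsFeasible x) (i j : Fin n) (a b : Fin R) :
    0 ≤ inner ℝ (dir x i a) (dir x j b) := by
  rw [dir, dir, real_inner_smul_left, real_inner_smul_right]
  have := hx.inner_nonneg i j a b
  positivity

theorem IsFeasible.inner_dir_eq_zero (hx : IsFeasible x) (i : Fin n) {a b : Fin R} (h : a ≠ b) :
    inner ℝ (dir x i a) (dir x i b) = 0 := by
  rw [dir, dir, real_inner_smul_left, real_inner_smul_right, hx.inner_eq_zero i a b h]
  simp

/-- Bessel's inequality; the zero directions are dropped so that the rest is orthonormal. -/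
theorem IsFeasible.sum_inner_dir_sq_le (hx : IsFeasible x) (i : Fin n)
    {z : EuclideanSpace ℝ (Fin d)} (hz : ‖z‖ ≤ 1) :
    ∑ c, (inner ℝ (dir x i c) z) ^ 2 ≤ 1 := by
  classical
  have ho : Orthonormal ℝ (fun c : {c // x i c ≠ 0} => dir x i c) :=
    ⟨fun c => norm_dir c.2, fun c c' hc =>
      hx.inner_dir_eq_zero i (fun h => hc (Subtype.ext h))⟩
  have h1 := ho.sum_inner_products_le (x := z) (s := Finset.univ)
  have h2 : ∑ c, (inner ℝ (dir x i c) z) ^ 2 =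
      ∑ c : {c // x i c ≠ 0}, (inner ℝ (dir x i c) z) ^ 2 := by
    rw [← Finset.sum_subtype (Finset.univ.filter fun c => x i c ≠ 0) (by simp)
      (fun c => (inner ℝ (dir x i c) z) ^ 2), Finset.sum_filter_of_ne]
    intro c _ hc h
    simp [dir, h] at hc
  rw [h2]
  simp only [Real.norm_eq_abs, sq_abs] at h1
  exact h1.trans (pow_le_one₀ (norm_nonneg z) hz)

theorem IsFeasible.norm_le_one (hx : IsFeasible x) (i : Fin n) (a : Fin R) : ‖x i a‖ ≤ 1 := by
  have h := Finset.single_le_sum (f := fun a => ‖x i a‖ ^ 2) (fun a _ => sq_nonneg _)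
    (Finset.mem_univ a)
  rw [hx.sum_norm_sq i] at h
  exact (sq_le_one_iff₀ (norm_nonneg _)).1 h

/-- Cauchy–Schwarz gives `∑ ‖x_{i,a}‖ ≤ √R`, so each of the two terms of the target probability
contributes at most `1/2`. -/
theorem IsFeasible.sum_targetProb_le (hx : IsFeasible x) (hR : 0 < R) (i : Fin n) :
    ∑ a, targetProb x i a ≤ 1 := by
  have hR' : (0 : ℝ) < R := Nat.cast_pos.2 hR
  have h1 : ∑ a, ‖x i a‖ ≤ Real.sqrt R := by
    apply Real.le_sqrt_of_sq_le
    have := sq_sum_le_card_mul_sum_sq (s := Finset.univ) (f := fun a => ‖x i a‖)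
    rw [hx.sum_norm_sq i] at this
    simpa using this
  have h2 : ∑ a, targetProb x i a = (1 / 2) * ((∑ a, ‖x i a‖) / Real.sqrt R + 1) := by
    simp only [targetProb]
    rw [← Finset.mul_sum, Finset.sum_add_distrib, Finset.sum_div]
    simp [hR'.ne']
  have h3 : (∑ a, ‖x i a‖) / Real.sqrt R ≤ 1 := div_le_one_of_le₀ h1 (Real.sqrt_nonneg _)
  rw [h2]
  linarith

/-- The `1 / R` term serves to keep every threshold `O(√(log R))`, even for very short vectors. -/
theorem le_targetProb (i : Fin n) (a : Fin R) : 1 / (2 * (R : ℝ)) ≤ targetProb x i a := by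
  have : 0 ≤ ‖x i a‖ / Real.sqrt R := by positivity
  rw [targetProb, one_div_mul_eq_div, ← one_div_mul_one_div]
  linarith

theorem norm_div_le_targetProb (i : Fin n) (a : Fin R) :
    ‖x i a‖ / (2 * Real.sqrt R) ≤ targetProb x i a := by
  have : (0 : ℝ) ≤ 1 / R := by positivity
  have h : ‖x i a‖ / (2 * Real.sqrt R) = (1 / 2) * (‖x i a‖ / Real.sqrt R) := by ring
  rw [targetProb, h]
  linarith

theorem IsFeasible.targetProb_le (hx : IsFeasible x) (hR : 0 < R) (i : Fin n) (a : Fin R) :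
    targetProb x i a ≤ 1 / Real.sqrt R := by
  have hR' : (1 : ℝ) ≤ R := Nat.one_le_cast.2 hR
  have hs : 0 < Real.sqrt R := Real.sqrt_pos.2 (by linarith)
  have h1 : ‖x i a‖ / Real.sqrt R ≤ 1 / Real.sqrt R :=
    div_le_div_of_nonneg_right (hx.norm_le_one i a) hs.le
  have h2 : (1 : ℝ) / R ≤ 1 / Real.sqrt R :=
    one_div_le_one_div_of_le hs ((Real.sqrt_le_left (by linarith)).2 (by nlinarith))
  rw [targetProb]
  linarith

theorem IsFeasible.gaussianTail_threshold_targetProb (hx : IsFeasible x) (hR : 2 ≤ R)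
    (i : Fin n) (a : Fin R) :
    gaussianTail (threshold (targetProb x i a)) = targetProb x i a := by
  have hR' : (2 : ℝ) ≤ R := Nat.ofNat_le_cast.2 hR
  apply gaussianTail_threshold
  · exact lt_of_lt_of_le (by positivity) (le_targetProb i a)
  · refine (hx.targetProb_le (by omega) i a).trans_lt ?_
    rw [div_lt_one (Real.sqrt_pos.2 (by linarith)), Real.lt_sqrt (by norm_num)]
    linarith

theorem mem_shortList_iff {i : Fin n} {a : Fin R} (g : EuclideanSpace ℝ (Fin d)) :
    a ∈ shortList x g i ↔
      x i a ≠ 0 ∧ threshold (targetProb x i a) ≤ inner ℝ (dir x i a) g := by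
  simp only [shortList, Finset.mem_filter, Finset.mem_univ, true_and]
  refine and_congr_right fun h => ?_
  rw [dir, real_inner_smul_left, le_inv_mul_iff₀ (norm_pos_iff.2 h)]

theorem measurableSet_mem_shortList (i : Fin n) (a : Fin R) :
    MeasurableSet {g | a ∈ shortList x g i} := by
  simp only [mem_shortList_iff]
  have h : MeasurableSet {g : EuclideanSpace ℝ (Fin d) |
      threshold (targetProb x i a) ≤ inner ℝ (dir x i a) g} :=
    measurableSet_le measurable_const (by fun_prop)
  exact (MeasurableSet.const _).inter h

end Feasible

/-! ### Thresholds for large alphabets -/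

section Large

variable {n R d : ℕ} {x : VectorFamily n R d} {l : ℝ}

theorem exp_neg_sq_eq_inv (hR : 0 < R) (hlR : l ^ 2 = Real.log R) :
    Real.exp (-l ^ 2) = 1 / R := by
  rw [hlR, Real.exp_neg, Real.exp_log (Nat.cast_pos.2 hR), one_div]

theorem exp_neg_sq_div_two_eq (hR : 0 < R) (hlR : l ^ 2 = Real.log R) :
    Real.exp (-l ^ 2 / 2) = 1 / Real.sqrt R := by
  rw [neg_div, Real.exp_neg, hlR, Real.exp_half, Real.exp_log (Nat.cast_pos.2 hR), one_div]

theorem IsFeasible.half_le_threshold (hx : IsFeasible x) (hR : 2 ≤ R) (hl : 4 ≤ l)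
    (hlR : l ^ 2 = Real.log R) (i : Fin n) (a : Fin R) :
    l / 2 ≤ threshold (targetProb x i a) := by
  apply half_le_of_gaussianTail_le hl
  rw [hx.gaussianTail_threshold_targetProb hR, exp_neg_sq_div_two_eq (by omega) hlR]
  exact hx.targetProb_le (by omega) i a

theorem IsFeasible.threshold_le (hx : IsFeasible x) (hR : 2 ≤ R) (hl : 4 ≤ l)
    (hlR : l ^ 2 = Real.log R) (i : Fin n) (a : Fin R) :
    threshold (targetProb x i a) ≤ 2 * l := by
  apply le_of_le_gaussianTail hl
  rw [hx.gaussianTail_threshold_targetProb hR, exp_neg_sq_eq_inv (by omega) hlR,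
    one_div_mul_one_div]
  exact le_targetProb i a

/-- On an event cut out by two orthogonal projections, on which every other direction of variable
`i` is biased by at most `3 l` times its correlation with `z`, the expected length of the short
list is bounded. -/
theorem IsFeasible.sum_real_mem_shortList_le (hx : IsFeasible x) (hR : 2 ≤ R) (hl : 4 ≤ l)
    (hlR : l ^ 2 = Real.log R) {u v z : EuclideanSpace ℝ (Fin d)} (hu : ‖u‖ = 1)
    (hv : ‖v‖ = 1 ∨ v = 0) (huv : inner ℝ u v = 0) (hz : ‖z‖ ≤ 1) {S T : Set ℝ}
    (hS : MeasurableSet S) (hT : MeasurableSet T) (i : Fin n) (a : Fin R)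
    (h0 : ∀ c, c ≠ a → 0 ≤ inner ℝ (dir x i c) z)
    (hb : ∀ c, c ≠ a → ∀ g : EuclideanSpace ℝ (Fin d), inner ℝ u g ∈ S → inner ℝ v g ∈ T →
      inner ℝ (dir x i c) u * inner ℝ u g + inner ℝ (dir x i c) v * inner ℝ v g ≤
        3 * l * inner ℝ (dir x i c) z) :
    ∑ c, (stdGaussian (EuclideanSpace ℝ (Fin d))).real
        {g | (inner ℝ u g ∈ S ∧ inner ℝ v g ∈ T) ∧ c ∈ shortList x g i} ≤
      (2049 + 6 * Real.exp 8) * (stdGaussian (EuclideanSpace ℝ (Fin d))).real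
        {g | inner ℝ u g ∈ S ∧ inner ℝ v g ∈ T} := by
  set γ := stdGaussian (EuclideanSpace ℝ (Fin d))
  set A := γ.real {g | inner ℝ u g ∈ S ∧ inner ℝ v g ∈ T} with hA
  have hA0 : 0 ≤ A := measureReal_nonneg
  have hp0 : ∀ c, 0 ≤ targetProb x i c := fun c => le_trans (by positivity) (le_targetProb i c)
  have hsub : ∀ c, γ.real {g | (inner ℝ u g ∈ S ∧ inner ℝ v g ∈ T) ∧ c ∈ shortList x g i} ≤ A :=
    fun c => measureReal_mono fun g hg => hg.1
  -- The value `a` is charged `1`. Any other value is charged its target probability, inflated by a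
  -- constant, plus `2048 τ²`.
  have key : ∀ c, γ.real {g | (inner ℝ u g ∈ S ∧ inner ℝ v g ∈ T) ∧ c ∈ shortList x g i} ≤
      ((if c = a then 1 else 0) + (6 * Real.exp 8 * targetProb x i c +
        2048 * (inner ℝ (dir x i c) z) ^ 2)) * A := by
    intro c
    have hrest : 0 ≤ 6 * Real.exp 8 * targetProb x i c + 2048 * (inner ℝ (dir x i c) z) ^ 2 := by
      have := hp0 c
      positivity
    have hone : ∀ k : ℝ, 1 ≤ k →
        γ.real {g | (inner ℝ u g ∈ S ∧ inner ℝ v g ∈ T) ∧ c ∈ shortList x g i} ≤ k * A :=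
      fun k hk => (hsub c).trans (le_mul_of_one_le_left hA0 hk)
    by_cases hca : c = a
    · refine hone _ ?_
      rw [if_pos hca]
      linarith
    rw [if_neg hca, zero_add]
    by_cases hxc : x i c = 0
    · have : {g | (inner ℝ u g ∈ S ∧ inner ℝ v g ∈ T) ∧ c ∈ shortList x g i} = ∅ := by
        ext g
        simp [mem_shortList_iff, hxc]
      rw [this, measureReal_empty]
      positivity
    by_cases hτ : inner ℝ (dir x i c) z ≤ (1 / 12 : ℝ)
    · have ht1 := hx.half_le_threshold hR hl hlR i c
      have ht2 := hx.threshold_le hR hl hlR i c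
      have hτ0 := h0 c hca
      have hpos : 0 < threshold (targetProb x i c) - 3 * l * inner ℝ (dir x i c) z := by
        nlinarith
      have h1 := stdGaussian_real_and_le_inner_le hu hv huv (norm_dir hxc) hS hT hpos (hb c hca)
      have h2 := gaussianTail_shift_le hl ht1 ht2 hτ0 hτ
      rw [hx.gaussianTail_threshold_targetProb hR] at h2
      refine le_trans (measureReal_mono fun g hg => ?_) (h1.trans ?_)
      · exact ⟨hg.1, ((mem_shortList_iff g).1 hg.2).2⟩
      rw [mul_comm]
      exact mul_le_mul_of_nonneg_right h2 hA0
    -- For `τ > 1/12` the charge `2048 τ²` exceeds `1`, so the trivial bound is enough.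
    · refine hone _ ?_
      have h3 : 0 ≤ 6 * Real.exp 8 * targetProb x i c := by
        have := hp0 c
        positivity
      nlinarith
  calc _ ≤ ∑ c, ((if c = a then 1 else 0) + (6 * Real.exp 8 * targetProb x i c +
        2048 * (inner ℝ (dir x i c) z) ^ 2)) * A := Finset.sum_le_sum fun c _ => key c
    _ = (1 + (6 * Real.exp 8 * ∑ c, targetProb x i c +
        2048 * ∑ c, (inner ℝ (dir x i c) z) ^ 2)) * A := by
      rw [← Finset.sum_mul, Finset.sum_add_distrib, Finset.sum_add_distrib, Finset.mul_sum,
        Finset.mul_sum]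
      simp
    _ ≤ _ := by
      have h1 := hx.sum_targetProb_le (by omega) i
      have h2 := hx.sum_inner_dir_sq_le i hz
      have h3 := Real.exp_pos 8
      refine mul_le_mul_of_nonneg_right ?_ hA0
      nlinarith

end Large

/-! ### Orthogonal decomposition of a pair of unit vectors -/

section Decomposition

variable {E : Type*} [NormedAddCommGroup E] [InnerProductSpace ℝ E]

/-- One Gram–Schmidt step. When `w` is a multiple of `u`, both `v` and `r` vanish; `r ‖v‖ = r` and
the formula for `v` (with `0⁻¹ = 0`) remain valid, so later arguments do not split cases. -/
theorem exists_orthogonal_decomposition {u w : E} (hu : ‖u‖ = 1) (hw : ‖w‖ = 1) :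
    ∃ (v : E) (r : ℝ), (‖v‖ = 1 ∨ v = 0) ∧ inner ℝ u v = 0 ∧ 0 ≤ r ∧ r * ‖v‖ = r ∧
      r ^ 2 = 1 - (inner ℝ u w : ℝ) ^ 2 ∧ w = (inner ℝ u w : ℝ) • u + r • v ∧
      v = r⁻¹ • (w - (inner ℝ u w : ℝ) • u) := by
  set ρ : ℝ := inner ℝ u w with hρ
  set q : E := w - ρ • u with hq
  have huu : inner ℝ u u = (1 : ℝ) := by rw [real_inner_self_eq_norm_sq, hu, one_pow]
  have hww : inner ℝ w w = (1 : ℝ) := by rw [real_inner_self_eq_norm_sq, hw, one_pow]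
  have huq : inner ℝ u q = (0 : ℝ) := by
    rw [hq, inner_sub_right, inner_smul_right, huu]; linarith
  have hqq : ‖q‖ ^ 2 = 1 - ρ ^ 2 := by
    rw [← real_inner_self_eq_norm_sq]
    conv_lhs => rw [hq, inner_sub_left, real_inner_smul_left, huq]
    rw [inner_sub_right, inner_smul_right, hww, real_inner_comm, ← hρ]
    ring
  refine ⟨‖q‖⁻¹ • q, ‖q‖, ?_, ?_, norm_nonneg q, ?_, hqq, ?_, rfl⟩
  · rcases eq_or_ne q 0 with h | h
    · right; simp [h]
    · left; rw [norm_smul, norm_inv, norm_norm, inv_mul_cancel₀ (norm_ne_zero_iff.2 h)]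
  · rw [inner_smul_right, huq, mul_zero]
  · rcases eq_or_ne q 0 with h | h
    · simp [h]
    · rw [norm_smul, norm_inv, norm_norm, inv_mul_cancel₀ (norm_ne_zero_iff.2 h), mul_one]
  · have h2 : ‖q‖ • ‖q‖⁻¹ • q = q := by
      rcases eq_or_ne q 0 with h | h
      · simp [h]
      · rw [smul_inv_smul₀ (norm_ne_zero_iff.2 h)]
    rw [h2, hq]
    abel

/-- Scaling the endpoints by `‖v‖` covers `v = 0`: the interval becomes `{0}` and the event is
certain. -/
theorem le_stdGaussian_real_inner_mem_Icc_norm_mul [FiniteDimensional ℝ E] [MeasurableSpace E]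
    [BorelSpace E] {v : E} (hv : ‖v‖ = 1 ∨ v = 0) (a b : ℝ) :
    gaussianTail a - gaussianTail b ≤
      (stdGaussian E).real {g | inner ℝ v g ∈ Set.Icc (‖v‖ * a) (‖v‖ * b)} := by
  rcases hv with hv | rfl
  · simpa [hv] using le_stdGaussian_real_inner_mem_Icc hv a b
  · have h1 : gaussianTail a ≤ 1 := measureReal_le_one
    have h2 := gaussianTail_nonneg b
    simp
    linarith

end Decomposition

/-! ### A good event for a pair of values -/

section GoodEvent

variable {n R d : ℕ} {x : VectorFamily n R d}

/-- The value with the larger threshold is taken as the base direction `u`, so that `⟨u, g⟩ ≥ s`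
gives `⟨u, g⟩ ≥ t` as well. The caps at `3 l` bound the bias on the other values. -/
theorem IsFeasible.exists_event_of_threshold_le (hx : IsFeasible x) (hR : 2 ≤ R) {l : ℝ}
    (hl : 4 ≤ l) (hlR : l ^ 2 = Real.log R) (i j : Fin n) (a b : Fin R) (hxi : x i a ≠ 0)
    (hxj : x j b ≠ 0)
    (hle : threshold (targetProb x j b) ≤ threshold (targetProb x i a)) :
    ∃ A : Set (EuclideanSpace ℝ (Fin d)), MeasurableSet A ∧
      (∀ g ∈ A, a ∈ shortList x g i ∧ b ∈ shortList x g j) ∧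
      targetProb x i a * targetProb x j b * inner ℝ (dir x i a) (dir x j b) * Real.log R / 32 ≤
        (stdGaussian (EuclideanSpace ℝ (Fin d))).real A ∧
      ∑ c, (stdGaussian (EuclideanSpace ℝ (Fin d))).real {g | g ∈ A ∧ c ∈ shortList x g i} ≤
        (2049 + 6 * Real.exp 8) * (stdGaussian (EuclideanSpace ℝ (Fin d))).real A ∧
      ∑ c, (stdGaussian (EuclideanSpace ℝ (Fin d))).real {g | g ∈ A ∧ c ∈ shortList x g j} ≤
        (2049 + 6 * Real.exp 8) * (stdGaussian (EuclideanSpace ℝ (Fin d))).real A := by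
  have hu := norm_dir hxi
  have hw := norm_dir hxj
  have hρ0 := hx.inner_dir_nonneg i j a b
  have hρ1 : inner ℝ (dir x i a) (dir x j b) ≤ (1 : ℝ) := by
    have := real_inner_le_norm (dir x i a) (dir x j b)
    rwa [hu, hw, one_mul] at this
  obtain ⟨v, r, hv, huv, hr0, hrv, hr2, hdec, hvdef⟩ := exists_orthogonal_decomposition hu hw
  set u := dir x i a with hudef
  set w := dir x j b with hwdef
  set ρ : ℝ := inner ℝ u w with hρ
  set s := threshold (targetProb x i a) with hs
  set t := threshold (targetProb x j b) with ht
  have ht1 : l / 2 ≤ t := hx.half_le_threshold hR hl hlR j b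
  have ht2 : t ≤ 2 * l := hx.threshold_le hR hl hlR j b
  have ht0 : 0 < t := by linarith
  have hps : gaussianTail s = targetProb x i a := hx.gaussianTail_threshold_targetProb hR i a
  have hpt : gaussianTail t = targetProb x j b := hx.gaussianTail_threshold_targetProb hR j b
  -- Low enough that the window `[T, t]` has length `ρ t / 2`, yet high enough that `ρ t + r T ≥ t`.
  set T := t * (1 - ρ / 2) with hT
  have hT0 : 0 ≤ T := mul_nonneg ht0.le (by linarith)
  have hTt : T ≤ t := by nlinarith
  have hvn : ‖v‖ ≤ 1 := by
    rcases hv with hv | hv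
    · exact hv.le
    · simp [hv]
  have h3l : gaussianTail (3 * l) ≤ (1 / 4) * (1 / R) := by
    have := gaussianTail_three_mul_le hl
    rwa [exp_neg_sq_eq_inv (by omega) hlR] at this
  have hRi : 1 / (2 * (R : ℝ)) = (1 / 2) * (1 / R) := (one_div_mul_one_div _ _).symm
  have hpi : (1 / 2) * (1 / (R : ℝ)) ≤ targetProb x i a := hRi ▸ le_targetProb i a
  have hpj : (1 / 2) * (1 / (R : ℝ)) ≤ targetProb x j b := hRi ▸ le_targetProb j b
  have hS : MeasurableSet (Set.Icc s (3 * l)) := measurableSet_Icc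
  have hTm : MeasurableSet (Set.Icc (‖v‖ * T) (‖v‖ * (3 * l))) := measurableSet_Icc
  have hinv : 0 ≤ r⁻¹ := inv_nonneg.2 hr0
  refine ⟨{g | inner ℝ u g ∈ Set.Icc s (3 * l) ∧
    inner ℝ v g ∈ Set.Icc (‖v‖ * T) (‖v‖ * (3 * l))}, ?_, ?_, ?_, ?_, ?_⟩
  · exact (measurableSet_preimage (by fun_prop) hS).inter
      (measurableSet_preimage (by fun_prop) hTm)
  · rintro g ⟨hg1, hg2⟩
    refine ⟨(mem_shortList_iff g).2 ⟨hxi, hg1.1⟩, (mem_shortList_iff g).2 ⟨hxj, ?_⟩⟩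
    change t ≤ inner ℝ w g
    rw [hdec, inner_add_left, real_inner_smul_left, real_inner_smul_left]
    have h1 : r * T ≤ r * inner ℝ v g := by
      calc r * T = r * (‖v‖ * T) := by rw [← mul_assoc r ‖v‖, hrv]
        _ ≤ _ := mul_le_mul_of_nonneg_left hg2.1 hr0
    have h2 : ρ * t ≤ ρ * inner ℝ u g :=
      mul_le_mul_of_nonneg_left (hle.trans hg1.1) hρ0
    -- Multiplied by `t`, this is `ρ t + r T ≥ t`. It is checked after squaring, with `r² = 1 - ρ²`.
    have h3 : 1 - ρ ≤ r * (1 - ρ / 2) := by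
      apply le_of_sq_le_sq _ (mul_nonneg hr0 (by linarith))
      rw [mul_pow, hr2]
      have : (1 - ρ ^ 2) * (1 - ρ / 2) ^ 2 - (1 - ρ) ^ 2 =
        (1 - ρ) * (ρ * (1 - ρ * 3 / 4 + ρ ^ 2 / 4)) := by ring
      have h5 : 0 ≤ (1 - ρ) * (ρ * (1 - ρ * 3 / 4 + ρ ^ 2 / 4)) :=
        mul_nonneg (by linarith) (mul_nonneg hρ0 (by nlinarith))
      linarith
    have h4 : t * (1 - ρ) ≤ t * (r * (1 - ρ / 2)) := mul_le_mul_of_nonneg_left h3 ht0.le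
    have h5 : r * T = t * (r * (1 - ρ / 2)) := by rw [hT]; ring
    linarith
  · rw [stdGaussian_real_inner_mem_and₂ huv hS hTm]
    have h1 := le_stdGaussian_real_inner_mem_Icc hu s (3 * l)
    have h2 := le_stdGaussian_real_inner_mem_Icc_norm_mul hv T (3 * l)
    have h3 : targetProb x i a / 2 ≤ gaussianTail s - gaussianTail (3 * l) := by linarith
    have h4 : gaussianTail T / 2 ≤ gaussianTail T - gaussianTail (3 * l) := by
      have := gaussianTail_antitone hTt
      linarith
    -- The source of the `log R` gain: on `[T, t]` the density is at least its value at `t`, which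
    -- is at least `t` times the tail.
    have h5 : ρ * t / 2 * (t * targetProb x j b) ≤ gaussianTail T := by
      have h6 := le_gaussianTail_sub hT0 hTt
      have h7 := mul_gaussianTail_le ht0.le
      have h8 : t - T = ρ * t / 2 := by rw [hT]; ring
      rw [h8] at h6
      rw [hpt] at h7
      have h9 := mul_le_mul_of_nonneg_left h7 (show 0 ≤ ρ * t / 2 by positivity)
      linarith [gaussianTail_nonneg t]
    have hpi0 : 0 ≤ targetProb x i a := le_trans (by positivity) hpi
    have hpj0 : 0 ≤ targetProb x j b := le_trans (by positivity) hpj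
    have hlt : Real.log R ≤ 4 * t ^ 2 := by rw [← hlR]; nlinarith
    calc targetProb x i a * targetProb x j b * ρ * Real.log R / 32
        ≤ targetProb x i a * targetProb x j b * ρ * (4 * t ^ 2) / 32 := by gcongr
      _ = targetProb x i a / 2 * (ρ * t / 2 * (t * targetProb x j b) / 2) := by ring
      _ ≤ targetProb x i a / 2 * (gaussianTail T / 2) := by gcongr
      _ ≤ _ := mul_le_mul (h3.trans h1) (h4.trans h2)
        (div_nonneg (gaussianTail_nonneg T) two_pos.le) measureReal_nonneg
  -- The other directions of `i` are orthogonal to `u`, so only `v` biases them.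
  · refine hx.sum_real_mem_shortList_le hR hl hlR hu hv huv hvn hS hTm i a ?_ ?_
    all_goals
      intro c hc
      have hcu : inner ℝ (dir x i c) u = (0 : ℝ) := hx.inner_dir_eq_zero i hc
      have hcw : (0 : ℝ) ≤ inner ℝ (dir x i c) w := hx.inner_dir_nonneg i j c b
      have hcv : (0 : ℝ) ≤ inner ℝ (dir x i c) v := by
        rw [hvdef, inner_smul_right, inner_sub_right, inner_smul_right, hcu, mul_zero, sub_zero]
        exact mul_nonneg hinv hcw
    · exact hcv
    · intro g _ hg2
      have h1 : inner ℝ v g ≤ 3 * l :=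
        hg2.2.trans (mul_le_of_le_one_left (by linarith) hvn)
      rw [hcu, zero_mul, zero_add, mul_comm]
      exact mul_le_mul_of_nonneg_right h1 hcv
  -- The other directions of `j` are orthogonal to `w` and correlate nonnegatively with `u`, hence
  -- nonpositively with `v`. Since `⟨v, g⟩ ≥ 0` on the event, only `u` can raise them.
  · refine hx.sum_real_mem_shortList_le hR hl hlR hu hv huv hu.le hS hTm j b ?_ ?_
    all_goals
      intro c hc
      have hcw : inner ℝ (dir x j c) w = (0 : ℝ) := hx.inner_dir_eq_zero j hc
      have hcu : (0 : ℝ) ≤ inner ℝ (dir x j c) u := hx.inner_dir_nonneg j i c a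
    · exact hcu
    · intro g hg1 hg2
      have hcv : inner ℝ (dir x j c) v ≤ (0 : ℝ) := by
        rw [hvdef, inner_smul_right, inner_sub_right, inner_smul_right, hcw, zero_sub, mul_neg]
        exact neg_nonpos.2 (mul_nonneg hinv (mul_nonneg hρ0 hcu))
      have h1 : 0 ≤ inner ℝ v g := (mul_nonneg (norm_nonneg v) hT0).trans hg2.1
      have h2 : inner ℝ (dir x j c) u * inner ℝ u g ≤ inner ℝ (dir x j c) u * (3 * l) :=
        mul_le_mul_of_nonneg_left hg1.2 hcu
      have h3 := mul_nonpos_of_nonpos_of_nonneg hcv h1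
      rw [mul_comm (3 * l)]
      linarith

/-- For a large alphabet, there is an event of probability of order at least `p q ρ log R` on which
`a` and `b` are listed and, on average, the short lists have bounded length. -/
theorem IsFeasible.exists_event (hx : IsFeasible x) (hR : 2 ≤ R) {l : ℝ}
    (hl : 4 ≤ l) (hlR : l ^ 2 = Real.log R) (i j : Fin n) (a b : Fin R) (hxi : x i a ≠ 0)
    (hxj : x j b ≠ 0) :
    ∃ A : Set (EuclideanSpace ℝ (Fin d)), MeasurableSet A ∧
      (∀ g ∈ A, a ∈ shortList x g i ∧ b ∈ shortList x g j) ∧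
      targetProb x i a * targetProb x j b * inner ℝ (dir x i a) (dir x j b) * Real.log R / 32 ≤
        (stdGaussian (EuclideanSpace ℝ (Fin d))).real A ∧
      ∑ c, (stdGaussian (EuclideanSpace ℝ (Fin d))).real {g | g ∈ A ∧ c ∈ shortList x g i} ≤
        (2049 + 6 * Real.exp 8) * (stdGaussian (EuclideanSpace ℝ (Fin d))).real A ∧
      ∑ c, (stdGaussian (EuclideanSpace ℝ (Fin d))).real {g | g ∈ A ∧ c ∈ shortList x g j} ≤
        (2049 + 6 * Real.exp 8) * (stdGaussian (EuclideanSpace ℝ (Fin d))).real A := by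
  rcases le_total (threshold (targetProb x j b)) (threshold (targetProb x i a)) with h | h
  · exact hx.exists_event_of_threshold_le hR hl hlR i j a b hxi hxj h
  · obtain ⟨A, h1, h2, h3, h4, h5⟩ := hx.exists_event_of_threshold_le hR hl hlR j i b a hxj hxi h
    refine ⟨A, h1, fun g hg => (h2 g hg).symm, ?_, h5, h4⟩
    rwa [mul_comm (targetProb x i a), real_inner_comm]

/-- If `τ ≥ 0` bounds both thresholds, both values are listed with probability at least
`Pr[N ≥ τ]²`. -/
theorem IsFeasible.sq_gaussianTail_le (hx : IsFeasible x) {τ : ℝ} (hτ : 0 ≤ τ) (i j : Fin n)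
    (a b : Fin R) (hxi : x i a ≠ 0) (hxj : x j b ≠ 0) (hi : threshold (targetProb x i a) ≤ τ)
    (hj : threshold (targetProb x j b) ≤ τ) :
    gaussianTail τ ^ 2 ≤ (stdGaussian (EuclideanSpace ℝ (Fin d))).real
      {g | a ∈ shortList x g i ∧ b ∈ shortList x g j} := by
  have hu := norm_dir hxi
  have hw := norm_dir hxj
  have hρ0 := hx.inner_dir_nonneg i j a b
  obtain ⟨v, r, hv, huv, hr0, hrv, hr2, hdec, -⟩ := exists_orthogonal_decomposition hu hw
  set u := dir x i a with hudef
  set w := dir x j b with hwdef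
  set ρ : ℝ := inner ℝ u w with hρ
  have hmeas := stdGaussian_real_inner_mem_and₂ huv (measurableSet_Ici (a := τ))
    (measurableSet_Ici (a := ‖v‖ * τ))
  have h1 : (stdGaussian (EuclideanSpace ℝ (Fin d))).real {g | inner ℝ u g ∈ Set.Ici τ} =
      gaussianTail τ := stdGaussian_real_le_inner hu τ
  have h2 : gaussianTail τ ≤
      (stdGaussian (EuclideanSpace ℝ (Fin d))).real {g | inner ℝ v g ∈ Set.Ici (‖v‖ * τ)} := by
    rcases hv with hv | rfl
    · rw [hv, one_mul]
      exact (stdGaussian_real_le_inner hv τ).ge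
    · have h3 : gaussianTail τ ≤ 1 := measureReal_le_one
      simpa using h3
  calc gaussianTail τ ^ 2 = gaussianTail τ * gaussianTail τ := sq _
    _ ≤ _ := mul_le_mul_of_nonneg_left h2 (gaussianTail_nonneg τ)
    _ = (stdGaussian (EuclideanSpace ℝ (Fin d))).real
          {g | inner ℝ u g ∈ Set.Ici τ ∧ inner ℝ v g ∈ Set.Ici (‖v‖ * τ)} := by rw [hmeas, h1]
    _ ≤ _ := ?_
  refine measureReal_mono ?_
  rintro g ⟨hg1, hg2⟩
  refine ⟨(mem_shortList_iff g).2 ⟨hxi, hi.trans hg1⟩,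
    (mem_shortList_iff g).2 ⟨hxj, hj.trans ?_⟩⟩
  change τ ≤ inner ℝ w g
  rw [hdec, inner_add_left, real_inner_smul_left, real_inner_smul_left]
  have h3 : r * τ ≤ r * inner ℝ v g := by
    calc r * τ = r * (‖v‖ * τ) := by rw [← mul_assoc r ‖v‖, hrv]
      _ ≤ _ := mul_le_mul_of_nonneg_left hg2 hr0
  have h4 : ρ * τ ≤ ρ * inner ℝ u g := mul_le_mul_of_nonneg_left hg1 hρ0
  -- Indeed `(ρ + r)² = 1 + 2 ρ r`.
  have h5 : 1 ≤ ρ + r := by nlinarith [mul_nonneg hρ0 hr0]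
  nlinarith

end GoodEvent

/-! ### The law of the rounded assignment -/

section Rounding

variable {n R d : ℕ}

theorem pick_apply_some (L : Finset (Fin R)) (a : Fin R) :
    (pick L).toMeasure {some a} = if a ∈ L then ((L.card : ENNReal))⁻¹ else 0 := by
  rw [PMF.toMeasure_apply_singleton _ _ (measurableSet_singleton _), pick]
  split_ifs with h ha ha
  · rw [PMF.map_apply, tsum_eq_single a]
    · simp [PMF.uniformOfFinset_apply_of_mem h ha]
    · intro b hb
      simp [hb.symm]
  · rw [PMF.map_apply, ENNReal.tsum_eq_zero]
    intro b
    split_ifs with hb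
    · obtain rfl := Option.some.inj hb
      exact PMF.uniformOfFinset_apply_of_notMem h ha
    · rfl
  · exact absurd ⟨a, ha⟩ h
  · simp

instance (L : Fin n → Finset (Fin R)) : IsProbabilityMeasure (pickLaw L) := by
  unfold pickLaw; infer_instance

instance (x : VectorFamily n R d) : IsMarkovKernel (roundingKernel x) :=
  ⟨fun g => inferInstanceAs (IsProbabilityMeasure (pickLaw (shortList x g)))⟩

instance (x : VectorFamily n R d) : IsProbabilityMeasure (roundingLaw x) := by
  unfold roundingLaw; infer_instance

theorem measurableSet_eq_some_and (i j : Fin n) (a b : Fin R) :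
    MeasurableSet {z : PartialAssignment n R | z i = some a ∧ z j = some b} :=
  (Set.toFinite _).measurableSet

theorem pickLaw_real_eq_some_and (L : Fin n → Finset (Fin R)) {i j : Fin n} (hij : i ≠ j)
    {a b : Fin R} (ha : a ∈ L i) (hb : b ∈ L j) :
    (pickLaw L).real {z | z i = some a ∧ z j = some b} =
      ((L i).card : ℝ)⁻¹ * ((L j).card : ℝ)⁻¹ := by
  have h1 : iIndepFun (fun k (z : PartialAssignment n R) => z k) (pickLaw L) :=
    iIndepFun_pi (X := fun _ z => z) fun _ => aemeasurable_id
  have h2 := (h1.indepFun hij).measure_inter_preimage_eq_mul {some a} {some b}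
    (measurableSet_singleton _) (measurableSet_singleton _)
  have h3 : ∀ k c, pickLaw L ((fun z : PartialAssignment n R => z k) ⁻¹' {some c}) =
      (pick (L k)).toMeasure {some c} := fun k c =>
    (measurePreserving_eval (fun k => (pick (L k)).toMeasure) k).measure_preimage
      (measurableSet_singleton _).nullMeasurableSet
  rw [h3, h3, pick_apply_some, pick_apply_some, if_pos ha, if_pos hb] at h2
  rw [measureReal_def]
  change (pickLaw L ((fun z : PartialAssignment n R => z i) ⁻¹' {some a} ∩
    (fun z : PartialAssignment n R => z j) ⁻¹' {some b})).toReal = _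
  rw [h2]
  simp

theorem measurable_pickLaw_real (x : VectorFamily n R d) {S : Set (PartialAssignment n R)}
    (hS : MeasurableSet S) : Measurable fun g => (pickLaw (shortList x g)).real S :=
  ((Measure.measurable_coe hS).comp (measurable_pickLaw_shortList x)).ennreal_toReal

theorem roundingLaw_real_eq_integral (x : VectorFamily n R d) {S : Set (PartialAssignment n R)}
    (hS : MeasurableSet S) : (roundingLaw x).real S =
      ∫ g, (pickLaw (shortList x g)).real S ∂(stdGaussian (EuclideanSpace ℝ (Fin d))) := by
  have h := integral_toReal (μ := stdGaussian (EuclideanSpace ℝ (Fin d)))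
    (f := fun g => pickLaw (shortList x g) S)
    ((Measure.measurable_coe hS).comp (measurable_pickLaw_shortList x)).aemeasurable
    (Filter.Eventually.of_forall fun g => measure_lt_top _ _)
  rw [measureReal_def, roundingLaw, Measure.bind_apply hS (Kernel.aemeasurable _)]
  exact h.symm

theorem integrable_pickLaw_real (x : VectorFamily n R d) {S : Set (PartialAssignment n R)}
    (hS : MeasurableSet S) : Integrable (fun g => (pickLaw (shortList x g)).real S)
      (stdGaussian (EuclideanSpace ℝ (Fin d))) := by
  refine Integrable.of_bound (measurable_pickLaw_real x hS).aestronglyMeasurable 1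
    (Filter.Eventually.of_forall fun g => ?_)
  rw [Real.norm_of_nonneg measureReal_nonneg]
  exact measureReal_le_one

theorem card_shortList_eq_sum (x : VectorFamily n R d) (i : Fin n)
    (g : EuclideanSpace ℝ (Fin d)) : ((shortList x g i).card : ℝ) =
      ∑ c, {g | c ∈ shortList x g i}.indicator (fun _ => (1 : ℝ)) g := by
  simp [Set.indicator_apply]

theorem integrable_indicator_mem_shortList (x : VectorFamily n R d) (i : Fin n) (c : Fin R)
    (A : Set (EuclideanSpace ℝ (Fin d))) :
    Integrable ({g | c ∈ shortList x g i}.indicator (fun _ => (1 : ℝ)))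
      ((stdGaussian (EuclideanSpace ℝ (Fin d))).restrict A) :=
  (integrable_const 1).indicator (measurableSet_mem_shortList i c)

theorem integrable_card_shortList (x : VectorFamily n R d) (i : Fin n)
    (A : Set (EuclideanSpace ℝ (Fin d))) :
    Integrable (fun g => ((shortList x g i).card : ℝ))
      ((stdGaussian (EuclideanSpace ℝ (Fin d))).restrict A) := by
  simp only [card_shortList_eq_sum]
  exact integrable_finsetSum _ fun c _ => integrable_indicator_mem_shortList x i c A

theorem setIntegral_card_shortList (x : VectorFamily n R d) (i : Fin n)
    (A : Set (EuclideanSpace ℝ (Fin d))) :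
    ∫ g in A, ((shortList x g i).card : ℝ) ∂(stdGaussian (EuclideanSpace ℝ (Fin d))) =
      ∑ c, (stdGaussian (EuclideanSpace ℝ (Fin d))).real {g | g ∈ A ∧ c ∈ shortList x g i} := by
  simp only [card_shortList_eq_sum]
  rw [integral_finsetSum _ fun c _ => integrable_indicator_mem_shortList x i c A]
  refine Finset.sum_congr rfl fun c _ => ?_
  rw [integral_indicator_const _ (measurableSet_mem_shortList i c),
    measureReal_restrict_apply (measurableSet_mem_shortList i c), smul_eq_mul, mul_one,
    Set.inter_comm]
  rfl

/-- The tangent plane at `(m, m)` lies below the convex function `1 / (k l)`. Integrating it does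
the work of Jensen's inequality and needs only the sum of the mean lengths, not their joint law. -/
theorem three_div_sq_sub_le {k l m : ℝ} (hk : 0 < k) (hl : 0 < l) (hm : 0 < m) :
    3 / m ^ 2 - (k + l) / m ^ 3 ≤ k⁻¹ * l⁻¹ := by
  have h1 : 3 * m * (k * l) ≤ m ^ 3 + (k + l) * (k * l) := by
    have hkl : 0 < k * l := mul_pos hk hl
    rcases le_total (3 * m) (k + l) with h | h
    · have := mul_le_mul_of_nonneg_right h hkl.le
      have := pow_pos hm 3
      linarith
    -- With `σ = k + l`, four times the difference of the two sides is `(3 m - σ)(k - l)² + (m +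
    -- σ)(2 m - σ)²`.
    · have h2 := mul_nonneg (sub_nonneg.2 h) (sq_nonneg (k - l))
      have h3 := mul_nonneg (show 0 ≤ m + (k + l) by positivity) (sq_nonneg (2 * m - (k + l)))
      linarith
  rw [← mul_inv, ← sub_nonneg]
  have h2 : (k * l)⁻¹ - (3 / m ^ 2 - (k + l) / m ^ 3) =
      (m ^ 3 + (k + l) * (k * l) - 3 * m * (k * l)) / (m ^ 3 * (k * l)) := by
    field_simp
    ring
  rw [h2]
  exact div_nonneg (by linarith) (by positivity)

/-- If on `A` both values are listed and the short lists have mean length at most `m`, then the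
values are picked with probability at least `Pr[A] / m²`. -/
theorem le_roundingLaw_real (x : VectorFamily n R d) {i j : Fin n} (hij : i ≠ j) (a b : Fin R)
    {A : Set (EuclideanSpace ℝ (Fin d))} (hA : MeasurableSet A)
    (hmem : ∀ g ∈ A, a ∈ shortList x g i ∧ b ∈ shortList x g j) {m : ℝ} (hm : 0 < m)
    (hi : ∑ c, (stdGaussian (EuclideanSpace ℝ (Fin d))).real {g | g ∈ A ∧ c ∈ shortList x g i} ≤
      m * (stdGaussian (EuclideanSpace ℝ (Fin d))).real A)
    (hj : ∑ c, (stdGaussian (EuclideanSpace ℝ (Fin d))).real {g | g ∈ A ∧ c ∈ shortList x g j} ≤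
      m * (stdGaussian (EuclideanSpace ℝ (Fin d))).real A) :
    (stdGaussian (EuclideanSpace ℝ (Fin d))).real A / m ^ 2 ≤
      (roundingLaw x).real {z | z i = some a ∧ z j = some b} := by
  set γ := stdGaussian (EuclideanSpace ℝ (Fin d))
  have hS := measurableSet_eq_some_and (n := n) (R := R) i j a b
  have hki := integrable_card_shortList x i A
  have hkj := integrable_card_shortList x j A
  have hint : IntegrableOn (fun g => 3 / m ^ 2 -
      (((shortList x g i).card : ℝ) + (shortList x g j).card) / m ^ 3) A γ :=
    (integrable_const _).sub ((hki.add hkj).div_const _)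
  have h1 : ∫ g in A, (3 / m ^ 2 -
      (((shortList x g i).card : ℝ) + (shortList x g j).card) / m ^ 3) ∂γ ≤
      ∫ g in A, (pickLaw (shortList x g)).real {z | z i = some a ∧ z j = some b} ∂γ := by
    refine setIntegral_mono_on hint (integrable_pickLaw_real x hS).integrableOn hA fun g hg => ?_
    obtain ⟨ha, hb⟩ := hmem g hg
    rw [pickLaw_real_eq_some_and _ hij ha hb]
    exact three_div_sq_sub_le (Nat.cast_pos.2 (Finset.card_pos.2 ⟨a, ha⟩))
      (Nat.cast_pos.2 (Finset.card_pos.2 ⟨b, hb⟩)) hm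
  have h2 : ∫ g in A, (pickLaw (shortList x g)).real {z | z i = some a ∧ z j = some b} ∂γ ≤
      (roundingLaw x).real {z | z i = some a ∧ z j = some b} := by
    rw [roundingLaw_real_eq_integral x hS]
    exact setIntegral_le_integral (integrable_pickLaw_real x hS)
      (Filter.Eventually.of_forall fun g => measureReal_nonneg)
  have h3 : ∫ g in A, (3 / m ^ 2 -
      (((shortList x g i).card : ℝ) + (shortList x g j).card) / m ^ 3) ∂γ =
      γ.real A * (3 / m ^ 2) -
        (∑ c, γ.real {g | g ∈ A ∧ c ∈ shortList x g i} +
          ∑ c, γ.real {g | g ∈ A ∧ c ∈ shortList x g j}) / m ^ 3 := by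
    have hadd : Integrable (fun g => (((shortList x g i).card : ℝ) + (shortList x g j).card))
        (γ.restrict A) := hki.add hkj
    rw [integral_sub (integrable_const _) (hadd.div_const _), integral_div (m ^ 3),
      integral_add hki hkj, setIntegral_card_shortList, setIntegral_card_shortList]
    simp [γ]
  have h4 : (∑ c, γ.real {g | g ∈ A ∧ c ∈ shortList x g i} +
      ∑ c, γ.real {g | g ∈ A ∧ c ∈ shortList x g j}) / m ^ 3 ≤
      (m * γ.real A + m * γ.real A) / m ^ 3 := by gcongr
  have h5 : γ.real A / m ^ 2 = γ.real A * (3 / m ^ 2) -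
      (m * γ.real A + m * γ.real A) / m ^ 3 := by
    field_simp
    ring
  linarith

end Rounding

/-! ### The probability of satisfying one constraint -/

section Constraint

variable {n R d : ℕ} {x : VectorFamily n R d}

/-- The norm terms of the two target probabilities multiply to `‖x_{i,a}‖ ‖x_{j,b}‖ / (4 R)`, which
turns `ρ` back into the inner product; `128 = 4 · 32`. -/
theorem IsFeasible.le_roundingLaw_real_of_large (hx : IsFeasible x) (hR : 2 ≤ R)
    (hlog : 16 ≤ Real.log R) {i j : Fin n} (hij : i ≠ j) (a b : Fin R) (hxi : x i a ≠ 0)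
    (hxj : x j b ≠ 0) :
    1 / (128 * (2049 + 6 * Real.exp 8) ^ 2) * (Real.log R / R) * inner ℝ (x i a) (x j b) ≤
      (roundingLaw x).real {z | z i = some a ∧ z j = some b} := by
  have hlR : Real.sqrt (Real.log R) ^ 2 = Real.log R := Real.sq_sqrt (by linarith)
  have hl : 4 ≤ Real.sqrt (Real.log R) := Real.le_sqrt_of_sq_le (by linarith)
  obtain ⟨A, hA, hmem, hlow, hi, hj⟩ := hx.exists_event hR hl hlR i j a b hxi hxj
  have hm : 0 < 2049 + 6 * Real.exp 8 := by positivity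
  refine le_trans ?_ (le_roundingLaw_real x hij a b hA hmem hm hi hj)
  refine le_trans ?_ (div_le_div_of_nonneg_right hlow (by positivity))
  have hR0 : (0 : ℝ) < R := by positivity
  have hρ := hx.inner_dir_nonneg i j a b
  have h1 : ‖x i a‖ * ‖x j b‖ / (4 * R) ≤ targetProb x i a * targetProb x j b := by
    have h2 : ‖x i a‖ * ‖x j b‖ / (4 * R) =
        ‖x i a‖ / (2 * Real.sqrt R) * (‖x j b‖ / (2 * Real.sqrt R)) := by
      rw [div_mul_div_comm]
      congr 1
      nlinarith [Real.mul_self_sqrt hR0.le]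
    rw [h2]
    exact mul_le_mul (norm_div_le_targetProb i a) (norm_div_le_targetProb j b) (by positivity)
      (le_trans (by positivity) (le_targetProb i a))
  calc 1 / (128 * (2049 + 6 * Real.exp 8) ^ 2) * (Real.log R / R) * inner ℝ (x i a) (x j b)
      = ‖x i a‖ * ‖x j b‖ / (4 * R) * inner ℝ (dir x i a) (dir x j b) * Real.log R / 32 /
          (2049 + 6 * Real.exp 8) ^ 2 := by
        rw [inner_eq_norm_mul_inner_dir]
        field_simp
        ring
    _ ≤ _ := by gcongr

theorem IsFeasible.le_roundingLaw_real_of_small (hx : IsFeasible x) (hR : 2 ≤ R)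
    (hlog : Real.log R ≤ 16) {i j : Fin n} (hij : i ≠ j) (a b : Fin R) (hxi : x i a ≠ 0)
    (hxj : x j b ≠ 0) :
    gaussianTail 8 ^ 2 * Real.exp (-32) * (Real.log R / R) * inner ℝ (x i a) (x j b) ≤
      (roundingLaw x).real {z | z i = some a ∧ z j = some b} := by
  have hR0 : (0 : ℝ) < R := by positivity
  have hRe : (R : ℝ) ≤ Real.exp 16 := (Real.log_le_iff_le_exp hR0).1 hlog
  have hth : ∀ k c, threshold (targetProb x k c) ≤ 8 := by
    intro k c
    -- Here `l = 4` is a fixed level: `R ≤ e^16` makes every target probability at least `e^{-16} /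
    -- 2`.
    have := le_of_le_gaussianTail (l := 4) le_rfl (t := threshold (targetProb x k c)) (by
      rw [hx.gaussianTail_threshold_targetProb hR]
      refine le_trans ?_ (le_targetProb k c)
      rw [← one_div_mul_one_div, show (-4 ^ 2 : ℝ) = -16 by norm_num, Real.exp_neg, ← one_div]
      exact mul_le_mul_of_nonneg_left (one_div_le_one_div_of_le hR0 hRe) (by norm_num))
    linarith
  have hP := hx.sq_gaussianTail_le (by norm_num : (0 : ℝ) ≤ 8) i j a b hxi hxj (hth i a) (hth j b)
  set A : Set (EuclideanSpace ℝ (Fin d)) :=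
    {g | a ∈ shortList x g i ∧ b ∈ shortList x g j} with hAdef
  have hA : MeasurableSet A :=
    (measurableSet_mem_shortList i a).inter (measurableSet_mem_shortList j b)
  have hsum : ∀ k, ∑ c, (stdGaussian (EuclideanSpace ℝ (Fin d))).real
      {g | g ∈ A ∧ c ∈ shortList x g k} ≤
        R * (stdGaussian (EuclideanSpace ℝ (Fin d))).real A := by
    intro k
    refine (Finset.sum_le_card_nsmul _ _ _ fun c _ => measureReal_mono fun g hg => hg.1).trans ?_
    simp
  refine le_trans ?_ (le_roundingLaw_real x hij a b hA (fun g hg => hg) hR0 (hsum i) (hsum j))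
  have h1 : Real.log R / R ≤ 1 := div_le_one_of_le₀ (Real.log_le_self hR0.le) hR0.le
  have h2 : inner ℝ (x i a) (x j b) ≤ (1 : ℝ) := (real_inner_le_norm _ _).trans
    (mul_le_one₀ (hx.norm_le_one i a) (norm_nonneg _) (hx.norm_le_one j b))
  have h3 : Real.exp (-32) ≤ 1 / (R : ℝ) ^ 2 := by
    rw [show (-32 : ℝ) = -(16 + 16) by norm_num, Real.exp_neg, Real.exp_add, ← sq, ← one_div]
    exact one_div_le_one_div_of_le (by positivity) (by gcongr)
  have h4 : 0 ≤ Real.log R / R := div_nonneg (Real.log_natCast_nonneg R) hR0.le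
  calc _ ≤ gaussianTail 8 ^ 2 * Real.exp (-32) * 1 * 1 := by
        have := hx.inner_nonneg i j a b
        gcongr
    _ ≤ gaussianTail 8 ^ 2 * (1 / (R : ℝ) ^ 2) := by
        rw [mul_one, mul_one]
        gcongr
    _ = gaussianTail 8 ^ 2 / (R : ℝ) ^ 2 := by ring
    _ ≤ _ := by gcongr

theorem exists_const_le_roundingLaw_real :
    ∃ c : ℝ, 0 < c ∧ ∀ {n R d : ℕ} {x : VectorFamily n R d}, IsFeasible x → 2 ≤ R →
      ∀ {i j : Fin n}, i ≠ j → ∀ a b : Fin R,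
        c * (Real.log R / R) * inner ℝ (x i a) (x j b) ≤
          (roundingLaw x).real {z | z i = some a ∧ z j = some b} := by
  have hq := gaussianTail_pos 8
  refine ⟨min (1 / (128 * (2049 + 6 * Real.exp 8) ^ 2)) (gaussianTail 8 ^ 2 * Real.exp (-32)),
    lt_min (by positivity) (by positivity), ?_⟩
  intro n R d x hx hR i j hij a b
  by_cases hxi : x i a = 0
  · simp [hxi, measureReal_nonneg]
  by_cases hxj : x j b = 0
  · simp [hxj, measureReal_nonneg]
  have h0 : 0 ≤ Real.log R / R := div_nonneg (Real.log_natCast_nonneg R) (Nat.cast_nonneg R)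
  have h1 := hx.inner_nonneg i j a b
  rcases le_total 16 (Real.log R) with h | h
  · refine le_trans ?_ (hx.le_roundingLaw_real_of_large hR h hij a b hxi hxj)
    gcongr
    exact min_le_left _ _
  · refine le_trans ?_ (hx.le_roundingLaw_real_of_small hR h hij a b hxi hxj)
    gcongr
    exact min_le_right _ _

end Constraint

/-! ### Expected number of satisfied constraints -/

section Expectation

variable {n R d : ℕ}

theorem sdpObjective_cons (C : AndConstraint n R) (I : AndInstance n R)
    (x : VectorFamily n R d) :
    sdpObjective (C ::ₘ I) x = inner ℝ (x C.i C.a) (x C.j C.b) + sdpObjective I x := by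
  simp [sdpObjective]

open Classical in
theorem andSatCount_cons (C : AndConstraint n R) (I : AndInstance n R)
    (z : PartialAssignment n R) :
    andSatCount (C ::ₘ I) z = andSatCount I z + if C.Sat z then 1 else 0 :=
  Multiset.countP_cons _ _ _

theorem integral_andSatCount_cons (C : AndConstraint n R) (I : AndInstance n R)
    (x : VectorFamily n R d) :
    ∫ z, (andSatCount (C ::ₘ I) z : ℝ) ∂(roundingLaw x) =
      (roundingLaw x).real {z | z C.i = some C.a ∧ z C.j = some C.b} +
        ∫ z, (andSatCount I z : ℝ) ∂(roundingLaw x) := by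
  classical
  have h : ∀ z : PartialAssignment n R, (andSatCount (C ::ₘ I) z : ℝ) =
      {z : PartialAssignment n R | z C.i = some C.a ∧ z C.j = some C.b}.indicator
        (fun _ => (1 : ℝ)) z + andSatCount I z := by
    intro z
    rw [andSatCount_cons, Set.indicator_apply]
    push_cast
    rw [add_comm]
    congr
  simp only [h]
  rw [integral_add Integrable.of_finite Integrable.of_finite,
    integral_indicator_const _ (measurableSet_eq_some_and _ _ _ _)]
  simp

theorem le_integral_andSatCount {x : VectorFamily n R d} {k : ℝ}
    (h : ∀ {i j : Fin n}, i ≠ j → ∀ a b : Fin R, k * inner ℝ (x i a) (x j b) ≤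
      (roundingLaw x).real {z | z i = some a ∧ z j = some b}) (I : AndInstance n R) :
    k * sdpObjective I x ≤ ∫ z, (andSatCount I z : ℝ) ∂(roundingLaw x) := by
  induction I using Multiset.induction_on with
  | empty => simp [sdpObjective, andSatCount]
  | cons C I ih =>
    rw [sdpObjective_cons, integral_andSatCount_cons, mul_add]
    exact add_le_add (h C.ne C.a C.b) ih

end Expectation

/-! ### The reduction -/

section Reduction

variable {n R d : ℕ}

open Classical in
theorem andSatCount_add (I J : AndInstance n R) (z : PartialAssignment n R) :
    andSatCount (I + J) z = andSatCount I z + andSatCount J z :=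
  Multiset.countP_add _ _ _

open Classical in
-- An assignment picks at most one pair of values, so at most one of the split constraints can hold.
theorem andSatCount_split (C : Constraint n R) (z : PartialAssignment n R) :
    andSatCount C.split z = if C.Sat z then 1 else 0 := by
  have h : andSatCount C.split z = ((Finset.univ.filter fun q : Fin R × Fin R =>
      C.pred q.1 q.2 = true).filter fun q => z C.i = some q.1 ∧ z C.j = some q.2).card := by
    rw [andSatCount, Constraint.split, Multiset.countP_map]
    refine congrArg Multiset.card ?_
    rw [Finset.filter_val]
    exact Multiset.filter_congr fun q _ => Iff.rfl
  rw [h]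
  split_ifs with hC
  · obtain ⟨a, b, ha, hb, hab⟩ := hC
    rw [Finset.card_eq_one]
    refine ⟨(a, b), ?_⟩
    ext ⟨a', b'⟩
    simp only [Finset.mem_filter, Finset.mem_univ, true_and, Finset.mem_singleton,
      Prod.mk.injEq, ha, hb, Option.some.injEq]
    constructor
    · rintro ⟨-, rfl, rfl⟩
      exact ⟨rfl, rfl⟩
    · rintro ⟨rfl, rfl⟩
      exact ⟨hab, rfl, rfl⟩
  · rw [Finset.card_eq_zero, Finset.filter_eq_empty_iff]
    rintro ⟨a, b⟩ hab ⟨ha, hb⟩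
    exact hC ⟨a, b, ha, hb, (Finset.mem_filter.1 hab).2⟩

/-- The reduction preserves the number of satisfied constraints. -/
theorem andSatCount_reduce (I : Instance n R) (z : PartialAssignment n R) :
    andSatCount (reduce I) z = satCount I z := by
  classical
  induction I using Multiset.induction_on with
  | empty => simp [andSatCount, satCount, reduce]
  | cons C I ih =>
    have h1 : reduce (C ::ₘ I) = C.split + reduce I := Multiset.cons_bind _ _ _
    have h2 : satCount (C ::ₘ I) z = satCount I z + if C.Sat z then 1 else 0 :=
      Multiset.countP_cons _ _ _
    rw [h1, h2, andSatCount_add, andSatCount_split, ih, add_comm]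

end Reduction

/-! ### Optimal solutions of the relaxation -/

section Relaxation

variable {n R d : ℕ}

/-- The solution of the relaxation that encodes the assignment `σ`, given a unit vector `e`. -/
noncomputable def integralSolution (σ : Fin n → Fin R) (e : EuclideanSpace ℝ (Fin d)) :
    VectorFamily n R d := fun i a => if σ i = a then e else 0

theorem isFeasible_integralSolution (σ : Fin n → Fin R) {e : EuclideanSpace ℝ (Fin d)}
    (he : ‖e‖ = 1) : IsFeasible (integralSolution σ e) where
  sum_norm_sq i := by
    rw [Finset.sum_eq_single (σ i)]
    · simp [integralSolution, he]
    · intro a _ ha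
      simp [integralSolution, ha.symm]
    · simp
  inner_eq_zero i a b hab := by
    unfold integralSolution
    split_ifs with h1 h2
    · exact absurd (h1.symm.trans h2) hab
    all_goals simp
  inner_nonneg i j a b := by
    unfold integralSolution
    split_ifs
    · exact real_inner_self_nonneg
    all_goals simp

theorem sdpObjective_integralSolution (σ : Fin n → Fin R) {e : EuclideanSpace ℝ (Fin d)}
    (he : ‖e‖ = 1) (I : AndInstance n R) :
    sdpObjective I (integralSolution σ e) = andSatCount I fun i => some (σ i) := by
  classical
  induction I using Multiset.induction_on with
  | empty => simp [sdpObjective, andSatCount]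
  | cons C I ih =>
    rw [sdpObjective_cons, andSatCount_cons, ih, Nat.cast_add, add_comm]
    congr 1
    unfold integralSolution AndConstraint.Sat
    by_cases h1 : σ C.i = C.a <;> by_cases h2 : σ C.j = C.b <;> simp [h1, h2, he]

theorem exists_norm_eq_one (hd : 1 ≤ d) : ∃ e : EuclideanSpace ℝ (Fin d), ‖e‖ = 1 :=
  ⟨EuclideanSpace.single ⟨0, hd⟩ 1, by simp⟩

theorem continuous_sdpObjective (I : AndInstance n R) :
    Continuous fun x : VectorFamily n R d => sdpObjective I x := by
  induction I using Multiset.induction_on with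
  | empty => simpa [sdpObjective] using continuous_const
  | cons C I ih =>
    simp only [sdpObjective_cons]
    fun_prop

/-- The constraints are closed conditions, and the normalization bounds every vector by `1`; this is
what makes the maximum attained. -/
theorem isCompact_setOf_isFeasible : IsCompact {x : VectorFamily n R d | IsFeasible x} := by
  apply Metric.isCompact_of_isClosed_isBounded
  · have h : {x : VectorFamily n R d | IsFeasible x} =
        (⋂ i, {x | ∑ a, ‖x i a‖ ^ 2 = 1}) ∩
          ((⋂ i, ⋂ a, ⋂ b, ⋂ (_ : a ≠ b), {x | inner ℝ (x i a) (x i b) = (0 : ℝ)}) ∩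
            ⋂ i, ⋂ j, ⋂ a, ⋂ b, {x | (0 : ℝ) ≤ inner ℝ (x i a) (x j b)}) := by
      ext x
      simp only [Set.mem_ofPred_eq, Set.mem_inter_iff, Set.mem_iInter]
      exact ⟨fun h => ⟨h.1, h.2, h.3⟩, fun h => ⟨h.1, h.2.1, h.2.2⟩⟩
    rw [h]
    refine (isClosed_iInter fun i => isClosed_eq (by fun_prop) continuous_const).inter
      (IsClosed.inter ?_ ?_)
    · exact isClosed_iInter fun i => isClosed_iInter fun a => isClosed_iInter fun b =>
        isClosed_iInter fun _ => isClosed_eq (by fun_prop) continuous_const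
    · exact isClosed_iInter fun i => isClosed_iInter fun j => isClosed_iInter fun a =>
        isClosed_iInter fun b => isClosed_le continuous_const (by fun_prop)
  · refine (Metric.isBounded_closedBall (x := (0 : VectorFamily n R d)) (r := 1)).subset ?_
    intro x hx
    rw [mem_closedBall_zero_iff, pi_norm_le_iff_of_nonneg zero_le_one]
    intro i
    rw [pi_norm_le_iff_of_nonneg zero_le_one]
    exact hx.norm_le_one i

theorem exists_isOptimal (hR : 0 < R) (hd : 1 ≤ d) (I : AndInstance n R) :
    ∃ x : VectorFamily n R d, IsOptimal I x := by
  obtain ⟨e, he⟩ := exists_norm_eq_one hd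
  obtain ⟨x, hx, hmax⟩ := isCompact_setOf_isFeasible.exists_isMaxOn
    ⟨_, isFeasible_integralSolution (fun _ : Fin n => (⟨0, hR⟩ : Fin R)) he⟩
    (continuous_sdpObjective I).continuousOn
  exact ⟨x, hx, fun y hy => hmax hy⟩

theorem IsOptimal.opt_le {I : Instance n R} {x : VectorFamily n R d} (hR : 0 < R) (hd : 1 ≤ d)
    (hx : IsOptimal (reduce I) x) : (opt I : ℝ) ≤ sdpObjective (reduce I) x := by
  obtain ⟨e, he⟩ := exists_norm_eq_one hd
  obtain ⟨σ, -, hσ⟩ := Finset.exists_mem_eq_sup Finset.univ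
    ⟨(fun _ => ⟨0, hR⟩ : Fin n → Fin R), Finset.mem_univ _⟩
    (fun σ : Fin n → Fin R => satCount I fun i => some (σ i))
  rw [opt, hσ, ← andSatCount_reduce, ← sdpObjective_integralSolution σ he]
  exact hx.2 _ (isFeasible_integralSolution σ he)

end Relaxation

end TwoCSP

/-! ### Assembly of the two claims -/

open TwoCSP
theorem theorem1 :
    ∃ c : ℝ, 0 < c ∧ ∀ n R d : ℕ, 2 ≤ R → 1 ≤ d →
      (∀ (I : AndInstance n R) (x : VectorFamily n R d), IsFeasible x →
        c * (Real.log R / R) * sdpObjective I x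
          ≤ ∫ z, (andSatCount I z : ℝ) ∂(roundingLaw x)) ∧
      (∀ I : Instance n R,
        (∃ x : VectorFamily n R d, IsOptimal (reduce I) x) ∧
        ∀ x : VectorFamily n R d, IsOptimal (reduce I) x →
          (opt I : ℝ) ≤ sdpObjective (reduce I) x ∧
          c * (Real.log R / R) * (opt I : ℝ)
            ≤ ∫ z, (satCount I z : ℝ) ∂(roundingLaw x)) := by
  obtain ⟨c, hc, hprob⟩ := exists_const_le_roundingLaw_real
  refine ⟨c, hc, fun n R d hR hd => ?_⟩
  have hpart : ∀ (I : AndInstance n R) (x : VectorFamily n R d), IsFeasible x →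
      c * (Real.log R / R) * sdpObjective I x ≤
        ∫ z, (andSatCount I z : ℝ) ∂(roundingLaw x) := fun I x hx =>
    le_integral_andSatCount (fun hij a b => hprob hx hR hij a b) I
  refine ⟨hpart, fun I => ⟨exists_isOptimal (by omega) hd _, fun x hx => ?_⟩⟩
  have hopt := hx.opt_le (by omega) hd
  refine ⟨hopt, ?_⟩
  have h0 : 0 ≤ Real.log R / R := div_nonneg (Real.log_natCast_nonneg R) (Nat.cast_nonneg R)
  simp only [← andSatCount_reduce]
  exact (mul_le_mul_of_nonneg_left hopt (mul_nonneg hc.le h0)).trans (hpart _ x hx.1)
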